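/- Let $k\ge b>a\ge 1$ and $r\ge 1$ be integers. A partition $\pi=(\pi_1\ge\pi_2\ge\cdots\ge\pi_\ell)$ is a finite non-increasing sequence of positive integers (the empty one included), $|\pi|$ is the sum of its parts, and $\ell_{k,d}(\pi)$ is the number of its parts congruent to $d$ modulo $k$. Let $\mathcal P_{a,b,k,r}$ (resp. $\mathcal P'_{a,b,k,r}$) be the set of partitions all of whose parts are congruent to $a$ or $b$ modulo $k$ and in which no $r+1$ consecutive parts $\pi_i,\pi_{i+1},\dots,\pi_{i+r}$ are all congruent to $b$ (resp. all congruent to $a$) modulo $k$. Put $(x;q)_n=\prod_{i=0}^{n-1}(1-xq^i)$; for integers $A,B$ put $${A\brack B}_k=\frac{(q^k;q^k)_A}{(q^k;q^k)_B\,(q^k;q^k)_{A-B}}\ \text{ if } A\ge B\ge 0,\qquad {A\brack B}_k=0\ \text{ otherwise,}$$ and for $h\ge 0$, $s\ge 1$ put $$g_{k,r}(h,s)=\sum_{i\ge 0}(-1)^i q^{rk(i^2-i)/2}{s\brack i}_{rk}{h-ri+s-1\brack s-1}_k .$$ Then $$\sum_{\pi\in\mathcal P_{a,b,k,r}}\mu^{\ell_{k,a}(\pi)}\nu^{\ell_{k,b}(\pi)}q^{|\pi|}=1+\sum_{m\ge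 1}\frac{1}{(q^k;q^k)_m}\Bigl(\mu^m q^{ma}+\sum_{s\ge 1}\sum_{h\ge 0}\mu^{m-h-s}\nu^{h+s}q^{(m-h-s)a+(h+s)b+k(s^2-s)}{m-h-s+1\brack s}_k\, g_{k,r}(h,s)\Bigr)$$ and $$\sum_{\pi\in\mathcal P'_{a,b,k,r}}\mu^{\ell_{k,a}(\pi)}\nu^{\ell_{k,b}(\pi)}q^{|\pi|}=1+\sum_{m\ge 1}\frac{1}{(q^k;q^k)_m}\Bigl(\nu^m q^{mb}+\sum_{s\ge 1}\sum_{h\ge 0}\mu^{h+s}\nu^{m-h-s}q^{(h+s)a+(m-h-s)b+k(s-1)^2}\Bigl({m-h-s\brack s-1}_k+q^{k(h+2s-1)}{m-h-s\brack s}_k\Bigr)g_{k,r}(h,s)\Bigr),$$ where terms whose $q$-binomial coefficients vanish are read as $0$. Both identities hold as identities of formal power series in $q$, with $\mu,\nu$ in an arbitrary commutative ring (for instance indeterminates). They also hold for complex $\mu,\nu,q$ with $|q|<1$, with the sum over partitions and the sum over $m$ both absolutely convergent: the first whenever $|\mu q^a|<1$ and the second whenever $|\nu q^b|<1$. -/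

import Mathlib

open scoped PowerSeries.WithPiTopology

noncomputable section

/-- The integer partitions of all nonnegative integers: `π.1` is the weight `|π|` and `π.2` is a
partition of that number. The only partition of `0` is the empty one. -/
abbrev Ptn : Type := Σ n : ℕ, n.Partition

namespace Ptn

/-- The weight `|π|`. -/
def weight (π : Ptn) : ℕ := π.1

/-- The parts `π₁ ≥ π₂ ≥ ⋯ ≥ π_m`, as a non-increasing list. -/
def partsList (π : Ptn) : List ℕ := π.2.parts.sort (· ≥ ·)

/-- `ℓ_{k,d}(π)`: the number of parts (with multiplicity) congruent to `d` modulo `k`. -/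
def ell (k d : ℕ) (π : Ptn) : ℕ := π.2.parts.countP (fun x => x ≡ d [MOD k])

/-- There are `t` consecutive parts `π_i, …, π_{i+t-1}`, all congruent to `d` modulo `k`. -/
def HasConsecutive (k d t : ℕ) (π : Ptn) : Prop :=
  ∃ l : List ℕ, l <:+: π.partsList ∧ l.length = t ∧ ∀ x ∈ l, x ≡ d [MOD k]

end Ptn

/-- `𝒫_{a,b,k,r}`: every part is congruent to `a` or `b` modulo `k`, and there are no `r + 1`
consecutive parts congruent to `b` modulo `k`. -/
def classP (a b k r : ℕ) : Set Ptn :=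
  {π | (∀ x ∈ π.2.parts, x ≡ a [MOD k] ∨ x ≡ b [MOD k]) ∧ ¬ π.HasConsecutive k b (r + 1)}

/-- `𝒫'_{a,b,k,r}`: every part is congruent to `a` or `b` modulo `k`, and there are no `r + 1`
consecutive parts congruent to `a` modulo `k`. -/
def classP' (a b k r : ℕ) : Set Ptn :=
  {π | (∀ x ∈ π.2.parts, x ≡ a [MOD k] ∨ x ≡ b [MOD k]) ∧ ¬ π.HasConsecutive k a (r + 1)}

section Ring

variable {A : Type*} [CommRing A]

/-- `μ^{ℓ_{k,a}(π)} ν^{ℓ_{k,b}(π)} q^{|π|}`. -/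
def ptnTerm (a b k : ℕ) (μ ν q : A) (π : Ptn) : A :=
  μ ^ π.ell k a * ν ^ π.ell k b * q ^ π.weight

/-- The `q`-shifted factorial `(x; q)_n = (1 - x)(1 - xq) ⋯ (1 - xq^{n-1})`. -/
def qShifted (x q : A) (n : ℕ) : A := ∏ i ∈ Finset.range n, (1 - x * q ^ i)

/-- The `q`-binomial coefficient `[M, B]_k` in base `q^k`, for integers `M` and `B`: it is
`(q^k;q^k)_M / ((q^k;q^k)_B (q^k;q^k)_{M-B})` if `M ≥ B ≥ 0`, and `0` otherwise. The inverse
`Ring.inverse` is the true inverse of a unit; it is used for `q : ℂ` with `‖q‖ < 1` and for the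
variable `q` of a power series ring, where the denominators are units if `k ≥ 1`. -/
def qBinom (q : A) (k : ℕ) (M B : ℤ) : A :=
  if 0 ≤ B ∧ B ≤ M then
    qShifted (q ^ k) (q ^ k) M.toNat *
      Ring.inverse
        (qShifted (q ^ k) (q ^ k) B.toNat * qShifted (q ^ k) (q ^ k) (M - B).toNat)
  else 0

/-- `g_{k,r}(h,s) = ∑_{i ≥ 0} (-1)^i q^{rk(i²-i)/2} [s, i]_{rk} [h-ri+s-1, s-1]_k`; the terms
with `i > s` vanish. -/
def gSum (q : A) (k r h s : ℕ) : A :=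
  ∑ᶠ i : ℕ, (-1) ^ i * q ^ (r * k * (i ^ 2 - i) / 2) * qBinom q (r * k) s i *
    qBinom q k ((h : ℤ) - r * i + s - 1) ((s : ℤ) - 1)

/-- The `m`-th term of the series for `𝒫_{a,b,k,r}`. The `q`-binomial coefficient vanishes unless
`m - h - s ≥ s - 1 ≥ 0`, so the sum is finite, and the truncated subtraction in the exponents is
the true one in all terms that do not vanish. -/
def seriesTermP (a b k r : ℕ) (μ ν q : A) (m : ℕ) : A :=
  Ring.inverse (qShifted (q ^ k) (q ^ k) m) *
    (μ ^ m * q ^ (m * a) +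
      ∑ᶠ (s : ℕ) (_ : 1 ≤ s), ∑ᶠ h : ℕ,
        μ ^ (m - h - s) * ν ^ (h + s) *
          q ^ ((m - h - s) * a + (h + s) * b + k * (s ^ 2 - s)) *
          qBinom q k ((m : ℤ) - h - s + 1) s * gSum q k r h s)

/-- The `m`-th term of the series for `𝒫'_{a,b,k,r}`; the remarks on `seriesTermP` apply. -/
def seriesTermP' (a b k r : ℕ) (μ ν q : A) (m : ℕ) : A :=
  Ring.inverse (qShifted (q ^ k) (q ^ k) m) *
    (ν ^ m * q ^ (m * b) +
      ∑ᶠ (s : ℕ) (_ : 1 ≤ s), ∑ᶠ h : ℕ,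
        μ ^ (h + s) * ν ^ (m - h - s) *
          q ^ ((h + s) * a + (m - h - s) * b + k * (s - 1) ^ 2) *
          (qBinom q k ((m : ℤ) - h - s) ((s : ℤ) - 1) +
            q ^ (k * (h + 2 * s - 1)) * qBinom q k ((m : ℤ) - h - s) s) *
          gSum q k r h s)

/-- `∑_{π ∈ 𝒞} μ^{ℓ_{k,a}(π)} ν^{ℓ_{k,b}(π)} q^{|π|} = 1 + ∑_{m ≥ 1} T_m`, both sums being
(unconditionally) convergent. -/
def GenFunEq [TopologicalSpace A] (a b k : ℕ) (μ ν q : A) (𝒞 : Set Ptn) (T : ℕ → A) : Prop :=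
  Summable (fun π : 𝒞 => ptnTerm a b k μ ν q π) ∧
  Summable (fun m : ℕ+ => T m) ∧
  ∑' π : 𝒞, ptnTerm a b k μ ν q π = 1 + ∑' m : ℕ+, T m

end Ring

end

/-! Write the parts in non-decreasing order as `k * M + c` with level `M` and residue `c`, which is
`a` or `b`. Since `1 ≤ a < b ≤ k`, the levels weakly increase and must increase strictly exactly
when a part of residue `b` is followed by one of residue `a`. A partition is thus the same as a word
in two letters together with an arbitrary excess `e ≥ 0` of the level increase at each position. Put
`Q = q ^ k`. An increase lifts its part and all later ones, so the excesses of a partition with `m`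
parts sum to `1 / (Q;Q)_m`, independently of the word (`hasSum_codeTerm`). There remains a finite
sum over words of length `m` with bounded runs of one letter (`wordSum`), in which every descent
from `b` to `a` costs `Q` to the number of letters from that `a` on.

To evaluate it, let the limited letters form `s` blocks placed in the `n` gaps after or around the
free letters. Blocks are affected by different numbers of descents, so their sizes contribute
`∏_{i<s} (zQ^i + ⋯ + (zQ^i)^r)`, and the choice of gaps contributes `Q^(s(s-1)/2)` times a Gaussian
binomial coefficient; this is `gapSeries`. Its recursion in `n` removes the first gap
(`gapSeries_succ`). Since `1 + x + ⋯ + x^(r-1) = (1 - x^r) / (1 - x)`, the two `q`-binomial theorems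
identify the coefficients of the block product with `g_{k,r}` (`gSum_eq_coeff`).

Convergence is needed only for the sum over partitions, because grouping by length then gives the
sum over `m` (`genFunEq_of_summable`). For formal series there are finitely many partitions of each
weight. For complex numbers the sum is dominated by a product over part sizes
(`summable_prod_parts`). -/

noncomputable section

/-! ### Gaussian binomial coefficients without division. -/

section QBinomial

variable {A : Type*} [CommRing A]

/-- Gaussian binomial coefficients in base `p`, defined by the `q`-Pascal recursion. -/
def gauss (p : A) : ℕ → ℕ → A
  | _, 0 => 1
  | 0, _ + 1 => 0
  | n + 1, i + 1 => gauss p n i + p ^ (i + 1) * gauss p n (i + 1)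

@[simp] theorem gauss_zero_right (p : A) (n : ℕ) : gauss p n 0 = 1 := by
  cases n <;> rfl

@[simp] theorem gauss_zero_succ (p : A) (i : ℕ) : gauss p 0 (i + 1) = 0 := rfl

theorem gauss_succ_succ (p : A) (n i : ℕ) :
    gauss p (n + 1) (i + 1) = gauss p n i + p ^ (i + 1) * gauss p n (i + 1) := rfl

theorem gauss_eq_zero_of_lt (p : A) {n i : ℕ} (h : n < i) : gauss p n i = 0 := by
  induction n generalizing i with
  | zero =>
    obtain ⟨i, rfl⟩ := Nat.exists_eq_succ_of_ne_zero h.ne'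
    rfl
  | succ n ih =>
    obtain ⟨i, rfl⟩ := Nat.exists_eq_succ_of_ne_zero (Nat.ne_zero_of_lt h)
    rw [Nat.succ_eq_add_one, gauss_succ_succ, ih (by omega), ih (by omega)]
    simp

@[simp] theorem gauss_self (p : A) (n : ℕ) : gauss p n n = 1 := by
  induction n with
  | zero => simp
  | succ n ih => rw [gauss_succ_succ, ih, gauss_eq_zero_of_lt p (Nat.lt_succ_self n)]; simp

theorem map_gauss {B : Type*} [CommRing B] (f : A →+* B) (p : A) (n i : ℕ) :
    f (gauss p n i) = gauss (f p) n i := by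
  induction n generalizing i with
  | zero => cases i <;> simp
  | succ n ih => cases i <;> simp [gauss_succ_succ, ih]

/-- The second `q`-Pascal rule, multiplied by `p ^ i` to avoid a subtraction in the exponent. -/
theorem pow_mul_gauss_succ_succ (p : A) (n i : ℕ) :
    p ^ i * gauss p (n + 1) (i + 1) = p ^ i * gauss p n (i + 1) + p ^ n * gauss p n i := by
  induction n generalizing i with
  | zero => cases i <;> simp [gauss_succ_succ]
  | succ n ih =>
    cases i with
    | zero =>
      have h := ih 0
      rw [gauss_succ_succ p (n + 1)]
      simp only [gauss_zero_right, pow_zero, one_mul, mul_one, zero_add, pow_one] at h ⊢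
      rw [h, mul_add, ← add_assoc]
      have h2 := gauss_succ_succ p n 0
      simp only [gauss_zero_right, zero_add, pow_one] at h2
      rw [← h2, h]
      ring
    | succ i =>
      have h1 := ih i
      have h2 := ih (i + 1)
      rw [gauss_succ_succ p (n + 1) (i + 1)]
      have h3 := gauss_succ_succ p n (i + 1)
      have h4 := gauss_succ_succ p n i
      linear_combination p * h1 + p ^ (i + 2) * h2 - p ^ (i + 1) * h3 - p ^ (n + 1) * h4

theorem qShifted_self_succ (p : A) (n : ℕ) :
    qShifted p p (n + 1) = qShifted p p n * (1 - p ^ (n + 1)) := by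
  rw [qShifted, Finset.prod_range_succ, ← qShifted, pow_succ']

/-- The factorial formula with denominators cleared, so that no factor need be a unit; it follows
from the Pascal rule by double induction. -/
theorem gauss_mul_qShifted (p : A) (i j : ℕ) :
    gauss p (i + j) i * (qShifted p p i * qShifted p p j) = qShifted p p (i + j) := by
  induction i generalizing j with
  | zero => simp [qShifted]
  | succ i ihi =>
    induction j with
    | zero => simp [qShifted]
    | succ j ihj =>
      have h1 := ihi (j + 1)
      rw [show i + 1 + (j + 1) = (i + 1 + j) + 1 by ring, gauss_succ_succ,
        qShifted_self_succ p (i + 1 + j)]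
      rw [show i + (j + 1) = i + 1 + j by ring] at h1
      have h2 := qShifted_self_succ p i
      have h3 := qShifted_self_succ p j
      linear_combination (1 - p ^ (i + 1)) * h1 + p ^ (i + 1) * (1 - p ^ (j + 1)) * ihj +
        gauss p (i + 1 + j) i * qShifted p p (j + 1) * h2 +
        p ^ (i + 1) * gauss p (i + 1 + j) (i + 1) * qShifted p p (i + 1) * h3

theorem isUnit_qShifted {p : A} (hp : ∀ n, 1 ≤ n → IsUnit (1 - p ^ n)) (n : ℕ) :
    IsUnit (qShifted p p n) := by
  induction n with
  | zero => simp [qShifted]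
  | succ n ih => rw [qShifted_self_succ]; exact ih.mul (hp _ (by omega))

theorem qBinom_natCast {q : A} {k : ℕ} (hq : ∀ n, 1 ≤ n → IsUnit (1 - (q ^ k) ^ n)) (M B : ℕ) :
    qBinom q k M B = gauss (q ^ k) M B := by
  unfold qBinom
  by_cases h : B ≤ M
  · obtain ⟨j, rfl⟩ := Nat.exists_eq_add_of_le h
    rw [if_pos (by constructor <;> push_cast <;> omega)]
    have h1 : (((B + j : ℕ) : ℤ) - B).toNat = j := by push_cast; omega
    rw [h1, Int.toNat_natCast, Int.toNat_natCast, ← gauss_mul_qShifted, mul_assoc,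
      Ring.mul_inverse_cancel _ ((isUnit_qShifted hq _).mul (isUnit_qShifted hq _)), mul_one]
  · rw [if_neg (by omega), gauss_eq_zero_of_lt _ (by omega)]

theorem qBinom_of_lt {q : A} {k : ℕ} {M B : ℤ} (h : M < B) : qBinom q k M B = 0 :=
  if_neg (by omega)

/-- The finite `q`-binomial theorem. -/
theorem prod_one_sub_pow_mul (p y : A) (s : ℕ) :
    ∏ i ∈ Finset.range s, (1 - p ^ i * y) =
      ∑ i ∈ Finset.range (s + 1), (-1) ^ i * p ^ (i.choose 2) * gauss p s i * y ^ i := by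
  induction s generalizing y with
  | zero => simp
  | succ s ih =>
    -- The product of `s + 1` factors is `1 - y` times the product of `s` factors at `p * y`;
    -- comparing coefficients gives the Pascal rule.
    have h : ∀ i, (-1) ^ (i + 1) * p ^ ((i + 1).choose 2) * gauss p (s + 1) (i + 1) * y ^ (i + 1) =
        (-1) ^ (i + 1) * p ^ ((i + 1).choose 2) * gauss p s (i + 1) * (p * y) ^ (i + 1) -
        y * ((-1) ^ i * p ^ (i.choose 2) * gauss p s i * (p * y) ^ i) := by
      intro i
      rw [gauss_succ_succ, Nat.choose_succ_succ' i 1, Nat.choose_one_right]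
      ring
    have h0 : ∑ i ∈ Finset.range (s + 1),
          (-1) ^ (i + 1) * p ^ ((i + 1).choose 2) * gauss p s (i + 1) * (p * y) ^ (i + 1) + 1 =
        ∑ i ∈ Finset.range (s + 1), (-1) ^ i * p ^ (i.choose 2) * gauss p s i * (p * y) ^ i := by
      have h1 := Finset.sum_range_succ'
        (fun i => (-1) ^ i * p ^ (i.choose 2) * gauss p s i * (p * y) ^ i) (s + 1)
      rw [Finset.sum_range_succ, gauss_eq_zero_of_lt p (Nat.lt_succ_self s)] at h1
      simpa using h1.symm
    have h2 : ∏ i ∈ Finset.range s, (1 - p ^ (i + 1) * y) =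
        ∏ i ∈ Finset.range s, (1 - p ^ i * (p * y)) :=
      Finset.prod_congr rfl fun i _ => by ring
    rw [Finset.prod_range_succ', Finset.sum_range_succ', Finset.sum_congr rfl fun i _ => h i,
      Finset.sum_sub_distrib, ← Finset.mul_sum, h2, ih]
    simp only [gauss_zero_right, pow_zero, mul_one, one_mul, Nat.choose_zero_succ]
    linear_combination -h0

end QBinomial

/-! ### Block sizes and the sum `g_{k,r}`. -/

section BlockSeries

open PowerSeries

variable {A : Type*} [CommRing A]

/-- The generating function `∏_{i < s} (1 + zQ^i + ⋯ + (zQ^i)^{r-1})` in `z`. -/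
def blockSeries (Q : A) (r : ℕ) : ℕ → A⟦X⟧
  | 0 => 1
  | s + 1 => (∑ j ∈ Finset.range r, X ^ j) * rescale Q (blockSeries Q r s)

theorem rescale_C (Q x : A) : rescale Q (C x) = C x := by
  ext n
  rw [coeff_rescale, coeff_C]
  split_ifs with h <;> simp [h]

/-- Finite geometric sums with the denominators cleared: each factor satisfies `(1 + x + ⋯ +
x^(r-1)) (1 - x) = 1 - x^r` at `x = zQ^i`. -/
theorem blockSeries_mul_prod (Q : A) (r s : ℕ) :
    blockSeries Q r s * ∏ i ∈ Finset.range s, (1 - C Q ^ i * X) =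
      ∏ i ∈ Finset.range s, (1 - C (Q ^ r) ^ i * X ^ r) := by
  induction s with
  | zero => simp [blockSeries]
  | succ s ih =>
    have h := congrArg (rescale Q) ih
    simp only [map_mul, map_prod, map_sub, map_one, map_pow, rescale_X] at h
    rw [blockSeries, Finset.prod_range_succ', Finset.prod_range_succ']
    have h2 := mul_neg_geom_sum (X : A⟦X⟧) r
    have e1 : ∏ i ∈ Finset.range s, (1 - C Q ^ (i + 1) * X) =
        ∏ i ∈ Finset.range s, (1 - C Q ^ i * (C Q * X)) :=
      Finset.prod_congr rfl fun i _ => by ring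
    have e2 : ∏ i ∈ Finset.range s, (1 - C (Q ^ r) ^ (i + 1) * X ^ r) =
        ∏ i ∈ Finset.range s, (1 - (C Q ^ r) ^ i * (C Q * X) ^ r) :=
      Finset.prod_congr rfl fun i _ => by rw [map_pow]; ring
    simp only [rescale_C] at h
    rw [e1, e2, ← h]
    simp only [pow_zero, one_mul]
    linear_combination rescale Q (blockSeries Q r s) *
      (∏ i ∈ Finset.range s, (1 - C Q ^ i * (C Q * X))) * h2

/-- The `q`-binomial theorem with negative exponent. Multiplying by the last factor `1 - zQ^(s+1)`
lowers `s` by the Pascal rule. -/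
theorem mk_gauss_mul_prod (Q : A) (s : ℕ) :
    (mk fun h => gauss Q (h + s) s) * ∏ i ∈ Finset.range (s + 1), (1 - C Q ^ i * X) = 1 := by
  induction s with
  | zero =>
    simp only [gauss_zero_right, zero_add, Finset.prod_range_one, pow_zero, one_mul]
    exact mk_one_mul_one_sub_eq_one A
  | succ s ih =>
    rw [Finset.prod_range_succ, mul_comm (∏ i ∈ Finset.range (s + 1), _), ← mul_assoc]
    refine Eq.trans ?_ ih
    congr 1
    ext h
    rw [mul_sub, mul_one, map_sub, coeff_mk, ← map_pow, mul_comm, mul_assoc, coeff_C_mul, coeff_mk]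
    cases h with
    | zero => simp
    | succ h =>
      rw [coeff_succ_X_mul, coeff_mk, show h + 1 + (s + 1) = (h + 1 + s) + 1 by ring,
        gauss_succ_succ, show h + (s + 1) = h + 1 + s by ring]
      ring

theorem coeff_blockSeries_succ (Q : A) (r s h : ℕ) :
    coeff h (blockSeries Q r (s + 1)) =
      ∑ i ∈ Finset.range (s + 2), (-1) ^ i * (Q ^ r) ^ (i.choose 2) * gauss (Q ^ r) (s + 1) i *
        if r * i ≤ h then gauss Q (h - r * i + s) s else 0 := by
  have h1 : blockSeries Q r (s + 1) =
      (∏ i ∈ Finset.range (s + 1), (1 - C (Q ^ r) ^ i * X ^ r)) *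
        (mk fun h => gauss Q (h + s) s) := by
    rw [← blockSeries_mul_prod, mul_assoc, mul_comm (∏ i ∈ _, _), mk_gauss_mul_prod, mul_one]
  rw [h1, prod_one_sub_pow_mul, Finset.sum_mul, map_sum]
  refine Finset.sum_congr rfl fun i _ => ?_
  have e : (-1 : A⟦X⟧) ^ i * C (Q ^ r) ^ (i.choose 2) * gauss (C (Q ^ r)) (s + 1) i =
      C ((-1) ^ i * (Q ^ r) ^ (i.choose 2) * gauss (Q ^ r) (s + 1) i) := by
    rw [map_mul, map_mul, map_gauss]; simp
  rw [e, mul_assoc, coeff_C_mul, ← pow_mul X, coeff_X_pow_mul', coeff_mk]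

theorem gSum_eq_coeff {q : A} {k : ℕ} (hk : 1 ≤ k) (hq : ∀ n, 1 ≤ n → IsUnit (1 - q ^ n))
    {r : ℕ} (hr : 1 ≤ r) (h s : ℕ) :
    gSum q k r h (s + 1) = coeff h (blockSeries (q ^ k) r (s + 1)) := by
  have hQ : ∀ n, 1 ≤ n → IsUnit (1 - (q ^ k) ^ n) := fun n hn => by
    rw [← pow_mul]; exact hq _ (Nat.mul_pos hk hn)
  have hQr : ∀ n, 1 ≤ n → IsUnit (1 - (q ^ (r * k)) ^ n) := fun n hn => by
    rw [← pow_mul]; exact hq _ (Nat.mul_pos (Nat.mul_pos hr hk) hn)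
  rw [gSum, coeff_blockSeries_succ, finsum_eq_sum_of_support_subset (s := Finset.range (s + 2))]
  · refine Finset.sum_congr rfl fun i _ => ?_
    rw [qBinom_natCast hQr]
    have e1 : q ^ (r * k * (i ^ 2 - i) / 2) = ((q ^ k) ^ r) ^ (i.choose 2) := by
      rw [← pow_mul, ← pow_mul, Nat.choose_two_right, sq, ← Nat.mul_sub_one,
        Nat.mul_div_assoc _ (Nat.even_mul_pred_self i).two_dvd, mul_comm r k, mul_assoc]
    have e2 : (q ^ k) ^ r = q ^ (r * k) := by rw [← pow_mul, mul_comm]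
    rw [e1, e2]
    congr 1
    rw [show ((s + 1 : ℕ) : ℤ) - 1 = (s : ℕ) by push_cast; ring]
    by_cases hi : r * i ≤ h
    · rw [if_pos hi, ← qBinom_natCast hQ]
      congr 1
      push_cast [Nat.cast_sub hi]
      ring
    -- For `ri > h` the upper entry `h - ri + s` is below the lower entry `s`.
    · rw [if_neg hi, qBinom_of_lt]
      have : (h : ℤ) < r * i := by exact_mod_cast not_le.1 hi
      push_cast
      linarith
  · intro i hi
    by_contra hn
    refine hi ?_
    simp only [Finset.coe_range, Set.mem_Iio, not_lt] at hn
    dsimp only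
    rw [qBinom_of_lt (M := ((s + 1 : ℕ) : ℤ)) (by exact_mod_cast hn)]
    simp

end BlockSeries

/-! ### Words with bounded runs, weighted by their descents. -/

section WordSeries

open PowerSeries

variable {A : Type*} [CommRing A]

/-- The generating function, in the number of limited letters, of the words with `n - 1` free
letters whose limited letters form blocks of size at most `r`. -/
def gapSeries (Q : A) (r n : ℕ) : A⟦X⟧ :=
  ∑ s ∈ Finset.range (n + 1), C (Q ^ (s * (s - 1)) * gauss Q n s) * (X ^ s * blockSeries Q r s)

theorem X_mul_geom_mul_rescale (Q : A) (r s : ℕ) :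
    (∑ j ∈ Finset.range r, X ^ (j + 1)) * rescale Q (X ^ s * blockSeries Q r s) =
      C (Q ^ s) * (X ^ (s + 1) * blockSeries Q r (s + 1)) := by
  rw [map_mul, map_pow, rescale_X, blockSeries]
  simp only [pow_succ X, ← Finset.sum_mul, map_pow, mul_pow]
  ring

theorem X_mul_geom_mul_rescale_gapSeries (Q : A) (r n : ℕ) :
    (∑ j ∈ Finset.range r, X ^ (j + 1)) * rescale Q (gapSeries Q r n) =
      ∑ s ∈ Finset.range (n + 1),
        C (Q ^ (s * s) * gauss Q n s) * (X ^ (s + 1) * blockSeries Q r (s + 1)) := by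
  rw [gapSeries, map_sum, Finset.mul_sum]
  refine Finset.sum_congr rfl fun s _ => ?_
  rw [map_mul, rescale_C, mul_left_comm, X_mul_geom_mul_rescale, ← mul_assoc, ← map_mul]
  congr 2
  have : s * s = s * (s - 1) + s := by cases s <;> simp; ring
  rw [this]
  ring

theorem gapSeries_zero (Q : A) (r : ℕ) : gapSeries Q r 0 = 1 := by
  simp [gapSeries, blockSeries]

/-- The first gap is empty or holds a block of `1` to `r` limited letters. In the latter case the
descent after it puts a factor `Q` on each of the `n` free letters that follow (`Q ^ n`) and on each
later limited letter (`rescale Q`). The algebraic content is the second `q`-Pascal rule. -/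
theorem gapSeries_succ (Q : A) (r n : ℕ) :
    gapSeries Q r (n + 1) = gapSeries Q r n +
      C (Q ^ n) * ((∑ j ∈ Finset.range r, X ^ (j + 1)) * rescale Q (gapSeries Q r n)) := by
  have h0 : gapSeries Q r n = ∑ s ∈ Finset.range (n + 2),
      C (Q ^ (s * (s - 1)) * gauss Q n s) * (X ^ s * blockSeries Q r s) := by
    rw [Finset.sum_range_succ, gauss_eq_zero_of_lt Q (Nat.lt_succ_self n)]
    simp [gapSeries]
  rw [X_mul_geom_mul_rescale_gapSeries, h0, gapSeries, Finset.sum_range_succ',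
    Finset.sum_range_succ' _ (n + 1), Finset.mul_sum, add_right_comm, ← Finset.sum_add_distrib]
  congr 1
  · refine Finset.sum_congr rfl fun s _ => ?_
    rw [← mul_assoc (C (Q ^ n)), ← map_mul, ← add_mul, ← map_add]
    congr 2
    have h := pow_mul_gauss_succ_succ Q n s
    rw [Nat.add_sub_cancel, add_mul, one_mul, pow_add]
    linear_combination Q ^ (s * s) * h
  · simp

theorem sum_antidiagonal_shift {M : Type*} [AddCommMonoid M] (f : ℕ → ℕ → M) (n m : ℕ) :
    (∑ p ∈ Finset.HasAntidiagonal.antidiagonal m, if n ≤ p.2 then f p.1 (p.2 - n) else 0) =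
      if n ≤ m then ∑ p ∈ Finset.HasAntidiagonal.antidiagonal (m - n), f p.1 p.2 else 0 := by
  rw [Finset.Nat.sum_antidiagonal_eq_sum_range_succ (fun i j => if n ≤ j then f i (j - n) else 0),
    Finset.Nat.sum_antidiagonal_eq_sum_range_succ f, ← Finset.sum_filter]
  split_ifs with h
  · have : (Finset.range m.succ).filter (fun i => n ≤ m - i) = Finset.range (m - n).succ := by
      ext i
      simp only [Finset.mem_filter, Finset.mem_range]
      omega
    rw [this]
    exact Finset.sum_congr rfl fun i _ => by rw [Nat.sub_right_comm]
  · rw [Finset.filter_false_of_mem, Finset.sum_empty]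
    intro i _
    omega

/-- The convolution of `f` with the series of the nonempty blocks of at most `i` letters of
weight `w`. -/
def blockSum (w : A) (f : ℕ → A) (i m : ℕ) : A :=
  ∑ n ∈ Finset.range i, if n + 1 ≤ m then w ^ (n + 1) * f (m - (n + 1)) else 0

theorem blockSum_zero_left (w : A) (f : ℕ → A) (m : ℕ) : blockSum w f 0 m = 0 := by
  simp [blockSum]

theorem blockSum_zero_right (w : A) (f : ℕ → A) (i : ℕ) : blockSum w f i 0 = 0 := by
  simp [blockSum]

theorem blockSum_succ_succ (w : A) (f : ℕ → A) (i m : ℕ) :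
    blockSum w f (i + 1) (m + 1) = w * (f m + blockSum w f i m) := by
  simp only [blockSum, Finset.sum_range_succ' _ i, mul_add, Finset.mul_sum,
    Nat.add_le_add_iff_right, Nat.add_sub_add_right]
  rw [add_comm]
  congr 1
  · simp
  · refine Finset.sum_congr rfl fun n _ => ?_
    split_ifs
    · ring
    · simp

/-- Charging `Q` to each letter of the block and to each letter after it charges all `m` letters. -/
theorem blockSum_mul_base (w Q : A) (f : ℕ → A) (i m : ℕ) :
    blockSum (w * Q) (fun n => Q ^ n * f n) i m = Q ^ m * blockSum w f i m := by
  simp only [blockSum, Finset.mul_sum]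
  refine Finset.sum_congr rfl fun n _ => ?_
  split_ifs with h
  · obtain ⟨b, rfl⟩ := Nat.exists_eq_add_of_le h
    rw [Nat.add_sub_cancel_left]
    ring
  · simp

theorem coeff_geom_mul (r : ℕ) (f : A⟦X⟧) (h : ℕ) :
    coeff h ((∑ j ∈ Finset.range r, X ^ (j + 1)) * f) =
      ∑ j ∈ Finset.range r, if j + 1 ≤ h then coeff (h - (j + 1)) f else 0 := by
  rw [Finset.sum_mul, map_sum]
  exact Finset.sum_congr rfl fun j _ => by rw [coeff_X_pow_mul']

theorem sum_antidiagonal_geom (u v : A) (r m : ℕ) (f : ℕ → A⟦X⟧) :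
    ∑ p ∈ Finset.HasAntidiagonal.antidiagonal m, u ^ p.1 * v ^ p.2 *
        coeff p.2 ((∑ j ∈ Finset.range r, X ^ (j + 1)) * f p.1) =
      blockSum v (fun n => ∑ p ∈ Finset.HasAntidiagonal.antidiagonal n,
        u ^ p.1 * v ^ p.2 * coeff p.2 (f p.1)) r m := by
  simp only [coeff_geom_mul, Finset.mul_sum, blockSum]
  rw [Finset.sum_comm]
  refine Finset.sum_congr rfl fun j _ => ?_
  rw [← sum_antidiagonal_shift (fun a b => v ^ (j + 1) * (u ^ a * v ^ b * coeff b (f a)))]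
  refine Finset.sum_congr rfl fun p _ => ?_
  split_ifs with h
  · obtain ⟨b, hb⟩ := Nat.exists_eq_add_of_le h
    rw [hb, Nat.add_sub_cancel_left]
    ring
  · simp

/-- The generating function of the words of length `m` that are empty or start with the free
letter; `u` marks the free letters and `v` the limited ones. -/
def freeSum (u v Q : A) (r m : ℕ) : A :=
  ∑ p ∈ Finset.HasAntidiagonal.antidiagonal m,
    u ^ p.1 * v ^ p.2 * coeff p.2 (gapSeries Q r p.1)

theorem freeSum_zero (u v Q : A) (r : ℕ) : freeSum u v Q r 0 = 1 := by
  simp [freeSum, gapSeries_zero]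

theorem freeSum_mul_right (u v Q : A) (r m : ℕ) :
    freeSum u (v * Q) Q r m = ∑ p ∈ Finset.HasAntidiagonal.antidiagonal m,
      u ^ p.1 * v ^ p.2 * coeff p.2 (rescale Q (gapSeries Q r p.1)) :=
  Finset.sum_congr rfl fun p _ => by rw [coeff_rescale]; ring

theorem sum_coeff_gapSeries_succ (u v Q : A) (r m : ℕ) :
    ∑ p ∈ Finset.HasAntidiagonal.antidiagonal m,
        u ^ p.1 * v ^ p.2 * coeff p.2 (gapSeries Q r (p.1 + 1)) =
      freeSum u v Q r m + blockSum v (fun n => Q ^ n * freeSum u v Q r n) r m := by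
  have h : ∀ n, Q ^ n * freeSum u v Q r n = ∑ p ∈ Finset.HasAntidiagonal.antidiagonal n,
      u ^ p.1 * v ^ p.2 * coeff p.2 (C (Q ^ p.1) * rescale Q (gapSeries Q r p.1)) := by
    intro n
    rw [freeSum, Finset.mul_sum]
    refine Finset.sum_congr rfl fun p hp => ?_
    rw [coeff_C_mul, coeff_rescale, ← Finset.HasAntidiagonal.mem_antidiagonal.1 hp]
    ring
  simp only [h]
  rw [← sum_antidiagonal_geom u v r m fun n => C (Q ^ n) * rescale Q (gapSeries Q r n), freeSum,
    ← Finset.sum_add_distrib]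
  refine Finset.sum_congr rfl fun p _ => ?_
  rw [gapSeries_succ, map_add, mul_add, mul_left_comm]

/-- Remove the leading free letter: what is left is empty, starts with a free letter, or starts with
a block whose end charges `Q` to each of the `n` letters after it. -/
theorem freeSum_succ (u v Q : A) (r m : ℕ) :
    freeSum u v Q r (m + 1) =
      u * (freeSum u v Q r m + blockSum v (fun n => Q ^ n * freeSum u v Q r n) r m) := by
  rw [← sum_coeff_gapSeries_succ, freeSum, Finset.Nat.sum_antidiagonal_succ, Finset.mul_sum]
  simp only [gapSeries_zero, coeff_one, Nat.add_eq_zero_iff, one_ne_zero, and_false, if_false,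
    mul_zero, zero_add]
  exact Finset.sum_congr rfl fun p _ => by ring

/-- The generating function of the words of length `m` (`true` marks residue `b`, `false` residue
`a`) that may follow the letter `p` at the end of a run of `j` letters `lim`, when runs of the
letter `lim` have length at most `r`. -/
def wordSum (Q : A) (z : Bool → A) (lim : Bool) (r : ℕ) : Bool → ℕ → ℕ → A
  | _, _, 0 => 1
  | p, j, m + 1 => ∑ c : Bool, (if p = true ∧ c = false then Q ^ (m + 1) else 1) * z c *
      if c = lim then if j < r then wordSum Q z lim r c (j + 1) m else 0
      else wordSum Q z lim r c 0 m

/-- Inside a run of `j` limited letters, either the run ends at once, with a descent costing `Q ^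
m`, or it continues by at most `r - j` letters. Both cases are needed together, as the recursion of
`wordSum` alternates between them. -/
theorem wordSum_true_eq (Q : A) (z : Bool → A) {r : ℕ} (hr : 1 ≤ r) (m : ℕ) :
    wordSum Q z true r false 0 m = freeSum (z false) (z true) Q r m +
      blockSum (z true) (fun n => Q ^ n * freeSum (z false) (z true) Q r n) r m ∧
    ∀ j ≤ r, wordSum Q z true r true j m = Q ^ m * freeSum (z false) (z true) Q r m +
      blockSum (z true) (fun n => Q ^ n * freeSum (z false) (z true) Q r n) (r - j) m := by
  induction m with
  | zero => simp [wordSum, freeSum_zero, blockSum_zero_right]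
  | succ m ih =>
    obtain ⟨ih1, ih2⟩ := ih
    refine ⟨?_, fun j hj => ?_⟩
    · obtain ⟨i, rfl⟩ := Nat.exists_eq_add_of_le' hr
      have h := ih2 1 hr
      rw [Nat.add_sub_cancel] at h
      simp only [wordSum, Fintype.sum_bool, blockSum_succ_succ]
      simp [h, ih1, ← freeSum_succ, add_comm]
    · simp only [wordSum, Fintype.sum_bool, ih1]
      rcases hj.eq_or_lt with rfl | hjr
      · simp [blockSum_zero_left, mul_assoc, ← freeSum_succ]
      · obtain ⟨i, hi⟩ := Nat.exists_eq_add_of_lt hjr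
        rw [ih2 (j + 1) hjr, show r - j = i + 1 by omega, show r - (j + 1) = i by omega,
          blockSum_succ_succ]
        simp [mul_assoc, ← freeSum_succ, hjr, add_comm]

/-- Here the descent is at the start of a block of limited letters, so it charges the block itself
as well as what follows. If every block is preceded by a free letter, this only replaces the weight
of the limited letter by its product with `Q`. An initial block is charged `Q ^ m` after a letter
`b` and nothing after a letter `a`. -/
theorem wordSum_false_eq (Q : A) (z : Bool → A) {r : ℕ} (hr : 1 ≤ r) (m : ℕ) :
    wordSum Q z false r true 0 m = freeSum (z true) (z false * Q) Q r m +
      Q ^ m * blockSum (z false) (freeSum (z true) (z false * Q) Q r) r m ∧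
    ∀ j ≤ r, wordSum Q z false r false j m = freeSum (z true) (z false * Q) Q r m +
      blockSum (z false) (freeSum (z true) (z false * Q) Q r) (r - j) m := by
  have hs := fun n => freeSum_succ (z true) (z false * Q) Q r n
  simp only [blockSum_mul_base] at hs
  induction m with
  | zero => simp [wordSum, freeSum_zero, blockSum_zero_right]
  | succ m ih =>
    obtain ⟨ih1, ih2⟩ := ih
    refine ⟨?_, fun j hj => ?_⟩
    · obtain ⟨i, rfl⟩ := Nat.exists_eq_add_of_le' hr
      have h := ih2 1 hr
      rw [Nat.add_sub_cancel] at h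
      simp only [wordSum, Fintype.sum_bool, blockSum_succ_succ]
      simp [h, ih1, hs, mul_assoc]
    · simp only [wordSum, Fintype.sum_bool, ih1]
      rcases hj.eq_or_lt with rfl | hjr
      · simp [blockSum_zero_left, hs]
      · obtain ⟨i, hi⟩ := Nat.exists_eq_add_of_lt hjr
        rw [ih2 (j + 1) hjr, show r - j = i + 1 by omega, show r - (j + 1) = i by omega,
          blockSum_succ_succ]
        simp [hs, hjr]

theorem wordSum_true_start (Q : A) (z : Bool → A) {r : ℕ} (hr : 1 ≤ r) (m : ℕ) :
    wordSum Q z true r false 0 m = ∑ p ∈ Finset.HasAntidiagonal.antidiagonal m,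
      z false ^ p.1 * z true ^ p.2 * coeff p.2 (gapSeries Q r (p.1 + 1)) := by
  rw [sum_coeff_gapSeries_succ, (wordSum_true_eq Q z hr m).1]

theorem wordSum_false_start (Q : A) (z : Bool → A) {r : ℕ} (hr : 1 ≤ r) (m : ℕ) :
    wordSum Q z false r false 0 m = ∑ p ∈ Finset.HasAntidiagonal.antidiagonal m,
      z true ^ p.1 * z false ^ p.2 * coeff p.2 (rescale Q (gapSeries Q r p.1) +
        (∑ j ∈ Finset.range r, X ^ (j + 1)) * rescale Q (gapSeries Q r p.1)) := by
  have h := funext fun n => freeSum_mul_right (z true) (z false) Q r n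
  simp only [map_add, mul_add, Finset.sum_add_distrib]
  rw [sum_antidiagonal_geom (z true) (z false) r m fun n => rescale Q (gapSeries Q r n), ← h,
    ← freeSum_mul_right, (wordSum_false_eq Q z hr m).2 0 (Nat.zero_le r), Nat.sub_zero]

end WordSeries

/-! ### The terms of the stated series as word sums. -/

section SeriesTerm

open PowerSeries

variable {A : Type*} [CommRing A]

/-- The range of `s` is made independent of `n` and `β`, so that it can be exchanged with the sum
over the numbers of free and limited letters. The term without blocks is split off; it accounts for
the leading monomial of the series. -/
theorem coeff_gapSeries (Q : A) (r n : ℕ) {m β : ℕ} (hβ : β ≤ m) :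
    coeff β (gapSeries Q r n) = (if β = 0 then 1 else 0) + ∑ s ∈ Finset.range m,
      if s + 1 ≤ β then Q ^ ((s + 1) * s) * gauss Q n (s + 1) *
        coeff (β - (s + 1)) (blockSeries Q r (s + 1)) else 0 := by
  have h : gapSeries Q r n = ∑ s ∈ Finset.range (n + m + 1),
      C (Q ^ (s * (s - 1)) * gauss Q n s) * (X ^ s * blockSeries Q r s) := by
    refine Finset.sum_subset (Finset.range_subset_range.2 (by omega)) fun s _ hs => ?_
    rw [gauss_eq_zero_of_lt Q (by simpa using hs)]
    simp
  rw [h, Finset.sum_range_succ', map_add, add_comm]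
  congr 1
  · simp [blockSeries, coeff_one]
  · simp only [map_sum, coeff_C_mul, coeff_X_pow_mul']
    symm
    refine (Finset.sum_subset (by simp) fun s _ hs => ?_).trans
      (Finset.sum_congr rfl fun s _ => ?_)
    · rw [if_neg]
      simp only [Finset.mem_range, not_lt] at hs
      omega
    · simp

theorem coeff_geom_mul_rescale_gapSeries (Q : A) (r n : ℕ) {m β : ℕ} (hβ : β ≤ m) :
    coeff β ((∑ j ∈ Finset.range r, X ^ (j + 1)) * rescale Q (gapSeries Q r n)) =
      ∑ s ∈ Finset.range m, if s + 1 ≤ β then Q ^ (s * s) * gauss Q n s *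
        coeff (β - (s + 1)) (blockSeries Q r (s + 1)) else 0 := by
  have h : (∑ j ∈ Finset.range r, X ^ (j + 1)) * rescale Q (gapSeries Q r n) =
      ∑ s ∈ Finset.range (n + m + 1),
        C (Q ^ (s * s) * gauss Q n s) * (X ^ (s + 1) * blockSeries Q r (s + 1)) := by
    rw [X_mul_geom_mul_rescale_gapSeries]
    refine Finset.sum_subset (Finset.range_subset_range.2 (by omega)) fun s _ hs => ?_
    rw [gauss_eq_zero_of_lt Q (by simpa using hs)]
    simp
  rw [h]
  simp only [map_sum, coeff_C_mul, coeff_X_pow_mul']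
  symm
  refine (Finset.sum_subset (Finset.range_subset_range.2 (by omega)) fun s _ hs => ?_).trans
    (Finset.sum_congr rfl fun s _ => ?_)
  · rw [if_neg]
    simp only [Finset.mem_range, not_lt] at hs
    omega
  · simp

theorem sum_antidiagonal_blocks (u v : A) (m : ℕ) (f : ℕ → ℕ → ℕ → A) :
    ∑ p ∈ Finset.HasAntidiagonal.antidiagonal m, u ^ p.1 * v ^ p.2 *
        ((if p.2 = 0 then 1 else 0) + ∑ s ∈ Finset.range m,
          if s + 1 ≤ p.2 then f s p.1 (p.2 - (s + 1)) else 0) =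
      u ^ m + ∑ s ∈ Finset.range m, ∑ p ∈ Finset.HasAntidiagonal.antidiagonal (m - (s + 1)),
        u ^ p.1 * v ^ (p.2 + (s + 1)) * f s p.1 p.2 := by
  simp only [mul_add, Finset.sum_add_distrib, Finset.mul_sum]
  congr 1
  · rw [Finset.sum_eq_single (m, 0)]
    · simp
    · rintro ⟨i, j⟩ hp hne
      rw [Finset.HasAntidiagonal.mem_antidiagonal] at hp
      have : j ≠ 0 := by
        rintro rfl
        exact hne (by simpa using hp)
      simp [this]
    · simp
  · rw [Finset.sum_comm]
    refine Finset.sum_congr rfl fun s hs => ?_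
    have h := sum_antidiagonal_shift
      (fun i j => u ^ i * v ^ (j + (s + 1)) * f s i j) (s + 1) m
    rw [if_pos (by simpa using hs)] at h
    rw [← h]
    refine Finset.sum_congr rfl fun p _ => ?_
    split_ifs with h
    · rw [Nat.sub_add_cancel h]
    · simp

theorem finsum_blocks {m : ℕ} {T : ℕ → ℕ → A} (hT : ∀ s h, 1 ≤ s → m < h + s → T s h = 0) :
    ∑ᶠ (s : ℕ) (_ : 1 ≤ s), ∑ᶠ h : ℕ, T s h =
      ∑ s ∈ Finset.range m, ∑ p ∈ Finset.HasAntidiagonal.antidiagonal (m - (s + 1)),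
        T (s + 1) p.2 := by
  have h1 : ∀ s, 1 ≤ s → ∑ᶠ h : ℕ, T s h = ∑ h ∈ Finset.range (m + 1 - s), T s h := fun s hs => by
    refine finsum_eq_sum_of_support_subset _ fun h hh => ?_
    by_contra hn
    refine hh (hT s h hs ?_)
    simp only [Finset.coe_range, Set.mem_Iio, not_lt] at hn
    omega
  have h2 : ∑ᶠ (s : ℕ) (_ : 1 ≤ s), ∑ᶠ h : ℕ, T s h =
      ∑ s ∈ Finset.Ico 1 (m + 1), ∑ h ∈ Finset.range (m + 1 - s), T s h := by
    rw [← finsum_mem_coe_finset]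
    refine finsum_congr fun s => ?_
    by_cases hs : 1 ≤ s
    · rw [finsum_eq_if, finsum_eq_if, if_pos hs, h1 s hs]
      by_cases hm : s < m + 1
      · rw [if_pos (by simp [hs, hm])]
      · rw [Nat.sub_eq_zero_of_le (by omega)]
        simp
    · simp [hs]
  rw [h2, Finset.sum_Ico_eq_sum_range]
  refine Finset.sum_congr rfl fun s hs => ?_
  rw [Finset.Nat.sum_antidiagonal_eq_sum_range_succ (fun _ h => T (s + 1) h),
    ← Finset.sum_range_reflect, add_comm 1 s]
  have := Finset.mem_range.1 hs
  refine Finset.sum_congr (by congr 1; omega) fun h hh => ?_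
  congr 1
  omega

/-- The weights of the letters: `false` stands for a part congruent to `a`, `true` for a part
congruent to `b`. -/
def letterWeight (a b : ℕ) (μ ν q : A) (c : Bool) : A := if c then ν * q ^ b else μ * q ^ a

theorem isUnit_one_sub_pow_pow {q : A} {k : ℕ} (hk : 1 ≤ k)
    (hq : ∀ n, 1 ≤ n → IsUnit (1 - q ^ n)) (n : ℕ) (hn : 1 ≤ n) : IsUnit (1 - (q ^ k) ^ n) := by
  rw [← pow_mul]
  exact hq _ (Nat.mul_pos hk hn)

theorem seriesTermP_eq {a b k r : ℕ} (hk : 1 ≤ k) (hr : 1 ≤ r) {μ ν q : A}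
    (hq : ∀ n, 1 ≤ n → IsUnit (1 - q ^ n)) (m : ℕ) :
    seriesTermP a b k r μ ν q m = Ring.inverse (qShifted (q ^ k) (q ^ k) m) *
      wordSum (q ^ k) (letterWeight a b μ ν q) true r false 0 m := by
  rw [seriesTermP, wordSum_true_start _ _ hr]
  congr 1
  rw [Finset.sum_congr rfl fun p hp => by
    rw [coeff_gapSeries (q ^ k) r (p.1 + 1)
      (Nat.le.intro ((add_comm _ _).trans (Finset.HasAntidiagonal.mem_antidiagonal.1 hp)))],
    sum_antidiagonal_blocks _ _ m fun s i h => (q ^ k) ^ ((s + 1) * s) *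
      gauss (q ^ k) (i + 1) (s + 1) * coeff h (blockSeries (q ^ k) r (s + 1)), finsum_blocks]
  · congr 1
    · simp only [letterWeight, Bool.false_eq_true, if_false]
      ring
    · refine Finset.sum_congr rfl fun s hs => Finset.sum_congr rfl fun p hp => ?_
      have hm : m = p.1 + p.2 + (s + 1) := by
        have := Finset.HasAntidiagonal.mem_antidiagonal.1 hp
        have := Finset.mem_range.1 hs
        omega
      rw [gSum_eq_coeff hk hq hr, ← qBinom_natCast (isUnit_one_sub_pow_pow hk hq),
        show m - p.2 - (s + 1) = p.1 by omega,
        show (m : ℤ) - p.2 - (s + 1 : ℕ) + 1 = ((p.1 + 1 : ℕ) : ℤ) by rw [hm]; push_cast; ring,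
        show (s + 1) ^ 2 - (s + 1) = (s + 1) * s by rw [sq, ← Nat.mul_sub_one]; simp]
      simp only [letterWeight, Bool.false_eq_true, if_false, if_true]
      ring
  · intro s h hs hm
    rw [qBinom_of_lt (by omega)]
    simp

theorem seriesTermP'_eq {a b k r : ℕ} (hk : 1 ≤ k) (hr : 1 ≤ r) {μ ν q : A}
    (hq : ∀ n, 1 ≤ n → IsUnit (1 - q ^ n)) (m : ℕ) :
    seriesTermP' a b k r μ ν q m = Ring.inverse (qShifted (q ^ k) (q ^ k) m) *
      wordSum (q ^ k) (letterWeight a b μ ν q) false r false 0 m := by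
  rw [seriesTermP', wordSum_false_start _ _ hr]
  congr 1
  -- The two binomial coefficients in the second identity come from words without and with an
  -- initial block of limited letters: the former have `s + 1` blocks in `n` gaps, the latter `s`
  -- further blocks.
  have hc : ∀ n β, β ≤ m → coeff β (rescale (q ^ k) (gapSeries (q ^ k) r n) +
      (∑ j ∈ Finset.range r, X ^ (j + 1)) * rescale (q ^ k) (gapSeries (q ^ k) r n)) =
      (if β = 0 then 1 else 0) + ∑ s ∈ Finset.range m, if s + 1 ≤ β then
        ((q ^ k) ^ (β - (s + 1) + (s + 1) + (s + 1) * s) * gauss (q ^ k) n (s + 1) +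
          (q ^ k) ^ (s * s) * gauss (q ^ k) n s) *
          coeff (β - (s + 1)) (blockSeries (q ^ k) r (s + 1)) else 0 := by
    intro n β hβ
    rw [map_add, coeff_geom_mul_rescale_gapSeries _ _ _ hβ, coeff_rescale,
      coeff_gapSeries _ _ _ hβ, mul_add, add_assoc, Finset.mul_sum, ← Finset.sum_add_distrib]
    congr 1
    · split_ifs with h <;> simp [h]
    · refine Finset.sum_congr rfl fun s _ => ?_
      split_ifs with h
      · rw [Nat.sub_add_cancel h]
        ring
      · simp
  rw [Finset.sum_congr rfl fun p hp => by rw [hc p.1 p.2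
      (Nat.le.intro ((add_comm _ _).trans (Finset.HasAntidiagonal.mem_antidiagonal.1 hp)))],
    sum_antidiagonal_blocks _ _ m fun s i h => ((q ^ k) ^ (h + (s + 1) + (s + 1) * s) *
      gauss (q ^ k) i (s + 1) + (q ^ k) ^ (s * s) * gauss (q ^ k) i s) *
        coeff h (blockSeries (q ^ k) r (s + 1)), finsum_blocks]
  · congr 1
    · simp only [letterWeight, if_true]
      ring
    · refine Finset.sum_congr rfl fun s hs => Finset.sum_congr rfl fun p hp => ?_
      have hm : m = p.1 + p.2 + (s + 1) := by
        have := Finset.HasAntidiagonal.mem_antidiagonal.1 hp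
        have := Finset.mem_range.1 hs
        omega
      rw [gSum_eq_coeff hk hq hr, ← qBinom_natCast (isUnit_one_sub_pow_pow hk hq),
        ← qBinom_natCast (isUnit_one_sub_pow_pow hk hq),
        show m - p.2 - (s + 1) = p.1 by omega,
        show (m : ℤ) - p.2 - (s + 1 : ℕ) = (p.1 : ℤ) by rw [hm]; push_cast; ring,
        show ((s + 1 : ℕ) : ℤ) - 1 = (s : ℕ) by push_cast; ring,
        show p.2 + 2 * (s + 1) - 1 = p.2 + 2 * s + 1 by omega, Nat.add_sub_cancel]
      simp only [letterWeight, Bool.false_eq_true, if_false, if_true]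
      ring
  · intro s h hs hm
    rw [qBinom_of_lt (by omega), qBinom_of_lt (by omega)]
    simp

end SeriesTerm

/-! ### Partitions as words with level excesses. -/

section Decode

/-- The increase of the level forced by the letter `c` following the letter `p` in a
non-decreasing sequence of parts: a part congruent to `a` cannot have the level of a preceding part
congruent to `b`. -/
def levelStep (p c : Bool) : ℕ := if p = true ∧ c = false then 1 else 0

/-- The residue that a letter stands for. -/
def letterResidue (a b : ℕ) (c : Bool) : ℕ := if c then b else a

/-- The non-decreasing list of parts with prescribed residues and prescribed increases of the level
beyond the forced ones. -/
def decode (a b k : ℕ) : Bool → ℕ → List (Bool × ℕ) → List ℕ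
  | _, _, [] => []
  | p, L, (c, e) :: t => (k * (L + e + levelStep p c) + letterResidue a b c) ::
      decode a b k c (L + e + levelStep p c) t

variable {a b k : ℕ}

theorem letterResidue_pos (ha : 1 ≤ a) (hab : a < b) (c : Bool) : 1 ≤ letterResidue a b c := by
  cases c <;> simp [letterResidue] <;> omega

theorem letterResidue_le (hab : a < b) (hbk : b ≤ k) (c : Bool) : letterResidue a b c ≤ k := by
  cases c <;> simp [letterResidue] <;> omega

theorem le_of_level_le (ha : 1 ≤ a) (hab : a < b) (hbk : b ≤ k) {M M' : ℕ} {c c' : Bool}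
    (h : k * M + letterResidue a b c ≤ k * M' + letterResidue a b c') : M ≤ M' := by
  by_contra hM
  have h1 : k * (M' + 1) ≤ k * M := Nat.mul_le_mul_left k (by omega)
  have h2 := letterResidue_pos ha hab c
  have h3 := letterResidue_le hab hbk c'
  rw [Nat.mul_add] at h1
  omega

theorem level_add_step_le (ha : 1 ≤ a) (hab : a < b) (hbk : b ≤ k) {M M' : ℕ} {c c' : Bool}
    (h : k * M + letterResidue a b c ≤ k * M' + letterResidue a b c') :
    M + levelStep c c' ≤ M' := by
  have h1 := le_of_level_le ha hab hbk h
  rcases h1.eq_or_lt with rfl | h1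
  · cases c <;> cases c' <;> simp_all [levelStep, letterResidue]
    omega
  · unfold levelStep
    split_ifs <;> omega

theorem level_unique (ha : 1 ≤ a) (hab : a < b) (hbk : b ≤ k) {M M' : ℕ} {c c' : Bool}
    (h : k * M + letterResidue a b c = k * M' + letterResidue a b c') : M = M' ∧ c = c' := by
  have h1 : M = M' := le_antisymm (le_of_level_le ha hab hbk h.le) (le_of_level_le ha hab hbk h.ge)
  subst h1
  refine ⟨rfl, ?_⟩
  cases c <;> cases c' <;> simp_all [letterResidue]

theorem isChain_decode (hab : a < b) (hbk : b ≤ k) (t : List (Bool × ℕ)) (p : Bool) (L : ℕ) :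
    List.IsChain (· ≤ ·) ((k * L + letterResidue a b p) :: decode a b k p L t) := by
  induction t generalizing p L with
  | nil => simp [decode]
  | cons x t ih =>
    obtain ⟨c, e⟩ := x
    rw [decode, List.isChain_cons_cons]
    refine ⟨?_, ih _ _⟩
    have h : k * L ≤ k * (L + e) := Nat.mul_le_mul_left k (by omega)
    cases p <;> cases c <;> simp [levelStep, letterResidue, Nat.mul_add] at h ⊢ <;> omega

theorem decode_injective (ha : 1 ≤ a) (hab : a < b) (hbk : b ≤ k) (p : Bool) (L : ℕ) :
    Function.Injective (decode a b k p L) := by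
  intro t
  induction t generalizing p L with
  | nil => intro t' h; cases t' <;> simp_all [decode]
  | cons x t ih =>
    intro t' h
    cases t' with
    | nil => simp [decode] at h
    | cons x' t' =>
      obtain ⟨c, e⟩ := x
      obtain ⟨c', e'⟩ := x'
      rw [decode, decode, List.cons.injEq] at h
      obtain ⟨h1, rfl⟩ := level_unique ha hab hbk h.1
      have h2 : e = e' := by omega
      subst h2
      rw [ih _ _ h.2]

theorem exists_level (hab : a < b) (hbk : b ≤ k) {x : ℕ} (hx : 1 ≤ x)
    (h : x ≡ a [MOD k] ∨ x ≡ b [MOD k]) : ∃ M c, x = k * M + letterResidue a b c := by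
  obtain ⟨c, hc⟩ : ∃ c, x ≡ letterResidue a b c [MOD k] := by
    rcases h with h | h
    exacts [⟨false, h⟩, ⟨true, h⟩]
  -- Otherwise `k` would divide a positive number below `k`; positivity of `x` matters when `b = k`.
  have hle : letterResidue a b c ≤ x := by
    by_contra hlt
    have h1 := (Nat.modEq_iff_dvd' (not_le.1 hlt).le).1 hc
    have h2 := Nat.le_of_dvd (by omega) h1
    have h3 := letterResidue_le hab hbk c
    omega
  obtain ⟨M, hM⟩ := (Nat.modEq_iff_dvd' hle).1 hc.symm
  exact ⟨M, c, by omega⟩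

theorem exists_decode_eq (ha : 1 ≤ a) (hab : a < b) (hbk : b ≤ k) (l : List ℕ) (p : Bool) (L : ℕ)
    (hl : List.IsChain (· ≤ ·) ((k * L + letterResidue a b p) :: l))
    (hr : ∀ x ∈ l, x ≡ a [MOD k] ∨ x ≡ b [MOD k]) : ∃ t, decode a b k p L t = l := by
  induction l generalizing p L with
  | nil => exact ⟨[], rfl⟩
  | cons x l ih =>
    rw [List.isChain_cons_cons] at hl
    have hp := letterResidue_pos ha hab p
    obtain ⟨M, c, rfl⟩ := exists_level hab hbk (by omega) (hr x (by simp))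
    obtain ⟨t, rfl⟩ := ih c M hl.2 fun y hy => hr y (by simp [hy])
    have hM := level_add_step_le ha hab hbk hl.1
    refine ⟨(c, M - (L + levelStep p c)) :: t, ?_⟩
    have : L + (M - (L + levelStep p c)) + levelStep p c = M := by omega
    rw [decode, this]

theorem mem_decode {t : List (Bool × ℕ)} {p : Bool} {L x : ℕ} (hx : x ∈ decode a b k p L t) :
    ∃ M c, x = k * M + letterResidue a b c := by
  induction t generalizing p L with
  | nil => simp [decode] at hx
  | cons y t ih =>
    obtain ⟨c, e⟩ := y
    rw [decode, List.mem_cons] at hx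
    rcases hx with rfl | hx
    exacts [⟨_, _, rfl⟩, ih hx]

theorem level_modEq_iff (ha : 1 ≤ a) (hab : a < b) (hbk : b ≤ k) (M : ℕ) (c d : Bool) :
    k * M + letterResidue a b c ≡ letterResidue a b d [MOD k] ↔ c = d := by
  have h0 : k * M + letterResidue a b c ≡ letterResidue a b c [MOD k] := by
    simp [Nat.ModEq]
  refine ⟨fun h => ?_, fun h => h ▸ h0⟩
  have h1 : a ≡ b [MOD k] → False := fun h1 => by
    have h2 := Nat.le_of_dvd (by omega) ((Nat.modEq_iff_dvd' hab.le).1 h1)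
    omega
  have h2 := h0.symm.trans h
  cases c <;> cases d <;> simp [letterResidue] at h2 ⊢
  exacts [h1 h2, h1 h2.symm]

theorem map_decode (ha : 1 ≤ a) (hab : a < b) (hbk : b ≤ k) (t : List (Bool × ℕ)) (p : Bool)
    (L : ℕ) :
    (decode a b k p L t).map (fun x => decide (x ≡ b [MOD k])) = t.map Prod.fst := by
  induction t generalizing p L with
  | nil => rfl
  | cons y t ih =>
    obtain ⟨c, e⟩ := y
    have h := level_modEq_iff ha hab hbk (L + e + levelStep p c) c true
    rw [show letterResidue a b true = b from rfl] at h
    rw [decode, List.map_cons, ih, List.map_cons, decide_eq_decide.2 h]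
    cases c <;> rfl

/-- The partition with the given code. -/
def codePtn (ha : 1 ≤ a) (hab : a < b) (t : List (Bool × ℕ)) : Ptn :=
  ⟨(decode a b k false 0 t).sum,
    { parts := decode a b k false 0 t
      parts_pos := fun {i} hi => by
        obtain ⟨M, c, rfl⟩ := mem_decode (Multiset.mem_coe.1 hi)
        have := letterResidue_pos ha hab c
        omega
      parts_sum := by simp }⟩

theorem Ptn.ext_parts {π π' : Ptn} (h : π.2.parts = π'.2.parts) : π = π' := by
  obtain ⟨n, P⟩ := π
  obtain ⟨n', P'⟩ := π'
  dsimp only at h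
  have h1 : n = n' := by rw [← P.parts_sum, ← P'.parts_sum, h]
  subst h1
  rw [Nat.Partition.ext h]

theorem pairwise_decode (hab : a < b) (hbk : b ≤ k) (t : List (Bool × ℕ)) :
    (decode a b k false 0 t).Pairwise (· ≤ ·) :=
  (List.isChain_iff_pairwise.1 (isChain_decode hab hbk t false 0)).of_cons

theorem partsList_codePtn (ha : 1 ≤ a) (hab : a < b) (hbk : b ≤ k) (t : List (Bool × ℕ)) :
    (codePtn (k := k) ha hab t).partsList = (decode a b k false 0 t).reverse := by
  refine List.Perm.eq_of_pairwise' (r := (· ≥ ·)) (Multiset.pairwise_sort _ _) ?_ ?_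
  · exact List.pairwise_reverse.2 (pairwise_decode hab hbk t)
  · rw [← Multiset.coe_eq_coe, Ptn.partsList, Multiset.sort_eq, Multiset.coe_reverse]
    rfl

theorem codePtn_injective (ha : 1 ≤ a) (hab : a < b) (hbk : b ≤ k) :
    Function.Injective (codePtn (k := k) ha hab) := fun t t' h => by
  have h1 := congrArg Ptn.partsList h
  rw [partsList_codePtn ha hab hbk, partsList_codePtn ha hab hbk, List.reverse_inj] at h1
  exact decode_injective ha hab hbk _ _ h1

theorem mem_range_codePtn (ha : 1 ≤ a) (hab : a < b) (hbk : b ≤ k) {π : Ptn}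
    (h : ∀ x ∈ π.2.parts, x ≡ a [MOD k] ∨ x ≡ b [MOD k]) :
    π ∈ Set.range (codePtn (k := k) ha hab) := by
  -- The code starts from a virtual part `a` at level `0`, the least admissible part, which forces
  -- no increase on the first letter.
  obtain ⟨t, ht⟩ := exists_decode_eq ha hab hbk (π.2.parts.sort (· ≤ ·)) false 0
    (by
      rw [List.isChain_iff_pairwise, List.pairwise_cons]
      refine ⟨fun x hx => ?_, Multiset.pairwise_sort _ _⟩
      rw [Multiset.mem_sort] at hx
      obtain ⟨M, c, rfl⟩ := exists_level hab hbk (π.2.parts_pos hx) (h x hx)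
      cases c <;> simp [letterResidue]
      omega)
    (by simpa using h)
  exact ⟨t, Ptn.ext_parts (by
    rw [← Multiset.sort_eq π.2.parts (· ≤ ·), ← ht]
    rfl)⟩

theorem codePtn_modEq (ha : 1 ≤ a) (hab : a < b) (t : List (Bool × ℕ)) :
    ∀ x ∈ (codePtn (k := k) ha hab t).2.parts, x ≡ a [MOD k] ∨ x ≡ b [MOD k] := by
  intro x hx
  obtain ⟨M, c, rfl⟩ := mem_decode (Multiset.mem_coe.1 hx)
  cases c <;> simp [letterResidue, Nat.ModEq]

/-- A word has no run of more than `r` letters `lim`, counting `j` letters `lim` in front of it. -/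
def RunsLE (lim : Bool) (r : ℕ) : ℕ → List Bool → Prop
  | _, [] => True
  | j, c :: w => if c = lim then j < r ∧ RunsLE lim r (j + 1) w else RunsLE lim r 0 w

theorem runsLE_iff (lim : Bool) (r : ℕ) (w : List Bool) {j : ℕ} (hj : j ≤ r) :
    RunsLE lim r j w ↔ ¬ List.replicate (r + 1) lim <:+: List.replicate j lim ++ w := by
  induction w generalizing j with
  | nil =>
    simp only [RunsLE, List.append_nil, true_iff]
    intro h
    have := h.length_le
    simp at this
    omega
  | cons c w ih =>
    rw [RunsLE]
    split_ifs with hc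
    · subst hc
      have e : List.replicate j c ++ c :: w = List.replicate (j + 1) c ++ w := by
        rw [List.replicate_succ', List.append_assoc]
        rfl
      rcases hj.eq_or_lt with rfl | hj
      · simp only [lt_irrefl, false_and, false_iff, not_not, e]
        exact (List.prefix_append _ _).isInfix
      · rw [ih hj, e]
        simp [hj]
    · rw [ih (Nat.zero_le r), not_iff_not, List.replicate_zero, List.nil_append]
      refine ⟨fun h => h.trans ((List.suffix_cons c w).isInfix.trans
        (List.suffix_append _ _).isInfix), fun h => ?_⟩
      -- A run of `r + 1` letters `lim` does not fit into the `j ≤ r` letters in front and cannot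
      -- contain `c`, so it lies in `w`.
      have hlen : ∀ {l : List Bool}, l = List.replicate (r + 1) lim →
          ¬ l <:+: List.replicate j lim := by
        rintro l rfl h
        have := h.length_le
        simp at this
        omega
      have hpre : ∀ {l : List Bool}, (∀ x ∈ l, x = lim) → l <+: c :: w → l = [] := by
        intro l hl hp
        cases l with
        | nil => rfl
        | cons x l =>
          rw [List.cons_prefix_cons] at hp
          exact absurd (hp.1.symm.trans (hl x (by simp))) hc
      rcases List.infix_append_iff.1 h with h | h | ⟨l₁, l₂, hl, h1, h2⟩
      · exact absurd h (hlen rfl)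
      · rcases List.infix_cons_iff.1 h with h | h
        · have := hpre (fun x hx => List.eq_of_mem_replicate hx) h
          simp at this
        · exact h
      · have h3 : l₂ = [] := hpre (fun x hx => List.eq_of_mem_replicate
          (hl ▸ List.mem_append_right l₁ hx : x ∈ List.replicate (r + 1) lim)) h2
        rw [h3, List.append_nil] at hl
        exact absurd h1.isInfix (hlen hl.symm)

theorem hasConsecutive_codePtn (ha : 1 ≤ a) (hab : a < b) (hbk : b ≤ k) (t : List (Bool × ℕ))
    (lim : Bool) (r : ℕ) :
    ¬ (codePtn (k := k) ha hab t).HasConsecutive k (letterResidue a b lim) (r + 1) ↔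
      RunsLE lim r 0 (t.map Prod.fst) := by
  rw [runsLE_iff lim r _ (Nat.zero_le r), not_iff_not, List.replicate_zero, List.nil_append,
    ← map_decode ha hab hbk t false 0, List.infix_map_iff, Ptn.HasConsecutive,
    partsList_codePtn ha hab hbk]
  have key : ∀ x ∈ decode a b k false 0 t,
      (x ≡ letterResidue a b lim [MOD k] ↔ decide (x ≡ b [MOD k]) = lim) := by
    intro x hx
    obtain ⟨M, c, rfl⟩ := mem_decode hx
    have h := level_modEq_iff ha hab hbk M c true
    rw [show letterResidue a b true = b from rfl] at h
    rw [level_modEq_iff ha hab hbk]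
    cases c <;> cases lim <;> simp [h]
  constructor
  · rintro ⟨l, hl, hlen, hmod⟩
    rw [← List.reverse_infix, List.reverse_reverse] at hl
    refine ⟨l.reverse, hl, ?_⟩
    symm
    rw [List.eq_replicate_iff]
    refine ⟨by simpa using hlen, fun y hy => ?_⟩
    obtain ⟨x, hx, rfl⟩ := List.mem_map.1 hy
    exact (key x (hl.subset hx)).1 (hmod x (List.mem_reverse.1 hx))
  · rintro ⟨l, hl, hlen⟩
    refine ⟨l.reverse, List.reverse_infix.2 hl, ?_, fun x hx => ?_⟩
    · simpa using (congrArg List.length hlen).symm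
    · rw [List.mem_reverse] at hx
      exact (key x (hl.subset hx)).2 (List.eq_of_mem_replicate
        (hlen ▸ List.mem_map_of_mem (f := fun x => decide (x ≡ b [MOD k])) hx))

end Decode

/-! ### Summation over codes and over the number of parts. -/

section CodeTerm

variable {A : Type*} [CommRing A]

/-- The contribution of a code to the generating function, where `p` is the preceding letter. -/
def codeWeight (Q : A) (z : Bool → A) : Bool → List (Bool × ℕ) → A
  | _, [] => 1
  | p, (c, e) :: t => (Q ^ (t.length + 1)) ^ e * ((Q ^ (t.length + 1)) ^ levelStep p c * z c *
      codeWeight Q z c t)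

/-- Starting at level `L` instead of `0` adds `k * L` to every part. -/
theorem term_decode {a b k : ℕ} (ha : 1 ≤ a) (hab : a < b) (hbk : b ≤ k) (μ ν q : A)
    (t : List (Bool × ℕ)) (p : Bool) (L : ℕ) :
    μ ^ (decode a b k p L t).countP (fun x => x ≡ a [MOD k]) *
        ν ^ (decode a b k p L t).countP (fun x => x ≡ b [MOD k]) * q ^ (decode a b k p L t).sum =
      (q ^ k) ^ (L * t.length) * codeWeight (q ^ k) (letterWeight a b μ ν q) p t := by
  induction t generalizing p L with
  | nil => simp [decode, codeWeight]
  | cons y t ih =>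
    obtain ⟨c, e⟩ := y
    have hf := level_modEq_iff ha hab hbk (L + e + levelStep p c) c false
    have ht := level_modEq_iff ha hab hbk (L + e + levelStep p c) c true
    rw [show letterResidue a b false = a from rfl] at hf
    rw [show letterResidue a b true = b from rfl] at ht
    have h := ih c (L + e + levelStep p c)
    rw [decode, List.countP_cons, List.countP_cons, List.sum_cons, codeWeight, List.length_cons]
    simp only [hf, ht, decide_eq_true_eq]
    cases c
    · simp only [letterResidue, letterWeight, if_true, Bool.false_eq_true, if_false, add_zero] at h ⊢
      linear_combination μ * q ^ a * (q ^ k) ^ (L + e + levelStep p false) * h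
    · simp only [letterResidue, letterWeight, if_true, Bool.true_eq_false, if_false, add_zero] at h ⊢
      linear_combination ν * q ^ b * (q ^ k) ^ (L + e + levelStep p true) * h

theorem ptnTerm_codePtn {a b k : ℕ} (ha : 1 ≤ a) (hab : a < b) (hbk : b ≤ k) (μ ν q : A)
    (t : List (Bool × ℕ)) :
    ptnTerm a b k μ ν q (codePtn (k := k) ha hab t) =
      codeWeight (q ^ k) (letterWeight a b μ ν q) false t := by
  have h := term_decode ha hab hbk μ ν q t false 0
  simpa [ptnTerm, Ptn.ell, Ptn.weight, codePtn] using h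

open Classical in
/-- The contribution of a code, set to `0` if a run of the letter `lim` is too long. -/
def codeTerm (Q : A) (z : Bool → A) (lim : Bool) (r : ℕ) (p : Bool) (j : ℕ)
    (t : List (Bool × ℕ)) : A :=
  if RunsLE lim r j (t.map Prod.fst) then codeWeight Q z p t else 0

theorem codeTerm_cons (Q : A) (z : Bool → A) (lim : Bool) (r : ℕ) (p : Bool) (j : ℕ)
    (c : Bool) (e : ℕ) (t : List (Bool × ℕ)) :
    codeTerm Q z lim r p j ((c, e) :: t) = (Q ^ (t.length + 1)) ^ e *
      ((if p = true ∧ c = false then Q ^ (t.length + 1) else 1) * z c *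
        if c = lim then if j < r then codeTerm Q z lim r c (j + 1) t else 0
        else codeTerm Q z lim r c 0 t) := by
  have h : (Q ^ (t.length + 1)) ^ levelStep p c =
      if p = true ∧ c = false then Q ^ (t.length + 1) else 1 := by
    unfold levelStep
    split_ifs <;> simp
  have hR : RunsLE lim r j (((c, e) :: t).map Prod.fst) ↔
      if c = lim then j < r ∧ RunsLE lim r (j + 1) (t.map Prod.fst)
      else RunsLE lim r 0 (t.map Prod.fst) := by
    rw [List.map_cons, RunsLE]
  classical
  rw [codeTerm, if_congr hR rfl rfl, codeWeight, h]
  simp only [codeTerm]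
  split_ifs <;> simp_all

variable [TopologicalSpace A] [IsTopologicalRing A] [T2Space A]

theorem isUnit_one_sub_of_summable {x : A} (h : Summable (x ^ · : ℕ → A)) : IsUnit (1 - x) :=
  IsUnit.of_mul_eq_one _ h.one_sub_mul_tsum_pow

theorem hasSum_pow_inverse {x : A} (h : Summable (x ^ · : ℕ → A)) :
    HasSum (x ^ · : ℕ → A) (Ring.inverse (1 - x)) := by
  have h1 : Ring.inverse (1 - x) = ∑' n, x ^ n := by
    have h2 := Ring.inverse_mul_cancel _ (isUnit_one_sub_of_summable h)
    linear_combination (∑' n, x ^ n) * h2 - Ring.inverse (1 - x) * h.one_sub_mul_tsum_pow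
  rw [h1]
  exact h.hasSum

/-- Prepending a letter with excess `e` contributes `(Q ^ (m + 1)) ^ e`, whose sum over `e` is the
new factor of `1 / (Q;Q)_(m+1)`. The hypothesis `hmul` on products of summable families lets the
formal and the complex case share one proof. -/
theorem hasSum_codeTerm {Q : A}
    (hmul : ∀ {ι κ : Type} (f : ι → A) (g : κ → A), Summable f → Summable g →
      Summable fun x : ι × κ => f x.1 * g x.2)
    (hQ : ∀ n, 1 ≤ n → Summable fun e : ℕ => (Q ^ n) ^ e) (z : Bool → A) (lim : Bool) (r m : ℕ)
    (p : Bool) (j : ℕ) :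
    HasSum (fun t : List.Vector (Bool × ℕ) m => codeTerm Q z lim r p j t.toList)
      (Ring.inverse (qShifted Q Q m) * wordSum Q z lim r p j m) := by
  induction m generalizing p j with
  | zero =>
    have h := hasSum_single (f := fun t : List.Vector (Bool × ℕ) 0 =>
      codeTerm Q z lim r p j t.toList) List.Vector.nil
      fun t ht => absurd (Subsingleton.elim t _) ht
    simpa [codeTerm, RunsLE, codeWeight, wordSum, qShifted] using h
  | succ m ih =>
    let E : (List.Vector (Bool × ℕ) m × ℕ) ⊕ (List.Vector (Bool × ℕ) m × ℕ) ≃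
        List.Vector (Bool × ℕ) (m + 1) :=
      { toFun := Sum.elim (fun x => (false, x.2) ::ᵥ x.1) (fun x => (true, x.2) ::ᵥ x.1)
        invFun := fun v => if v.head.1 then Sum.inr (v.tail, v.head.2)
          else Sum.inl (v.tail, v.head.2)
        left_inv := by rintro (x | x) <;> simp
        right_inv := by
          intro v
          obtain ⟨⟨c, e⟩, t, rfl⟩ := v.exists_eq_cons
          cases c <;> simp }
    rw [← E.hasSum_iff]
    let W : Bool → A := fun c => Ring.inverse (qShifted Q Q (m + 1)) *
      ((if p = true ∧ c = false then Q ^ (m + 1) else 1) * z c *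
        if c = lim then if j < r then wordSum Q z lim r c (j + 1) m else 0
        else wordSum Q z lim r c 0 m)
    have key : ∀ c : Bool, HasSum (fun x : List.Vector (Bool × ℕ) m × ℕ =>
        codeTerm Q z lim r p j (((c, x.2) ::ᵥ x.1).toList)) (W c) := by
      intro c
      have h1 : HasSum (fun t : List.Vector (Bool × ℕ) m =>
          if c = lim then if j < r then codeTerm Q z lim r c (j + 1) t.toList else 0
          else codeTerm Q z lim r c 0 t.toList)
          (Ring.inverse (qShifted Q Q m) *
            if c = lim then if j < r then wordSum Q z lim r c (j + 1) m else 0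
            else wordSum Q z lim r c 0 m) := by
        split_ifs
        · exact ih _ _
        · simp
        · exact ih _ _
      have h2 := h1.mul_left ((if p = true ∧ c = false then Q ^ (m + 1) else 1) * z c)
      have h3 := hasSum_pow_inverse (hQ (m + 1) (by omega))
      have hs := hmul _ _ h2.summable h3.summable
      have h4 := HasSum.mul h2 h3 hs
      have e : (if p = true ∧ c = false then Q ^ (m + 1) else 1) * z c *
          (Ring.inverse (qShifted Q Q m) *
            if c = lim then if j < r then wordSum Q z lim r c (j + 1) m else 0
            else wordSum Q z lim r c 0 m) * Ring.inverse (1 - Q ^ (m + 1)) = W c := by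
        simp only [W]
        rw [qShifted_self_succ, Ring.mul_inverse_rev]
        ring
      rw [e] at h4
      refine (congrArg (fun f => HasSum f (W c)) (funext fun x => ?_)).mpr h4
      rw [List.Vector.toList_cons, codeTerm_cons, List.Vector.toList_length]
      ring
    have hW : Ring.inverse (qShifted Q Q (m + 1)) * wordSum Q z lim r p j (m + 1) =
        W false + W true := by
      rw [wordSum, Fintype.sum_bool, mul_add, add_comm]
    rw [hW]
    exact HasSum.sum (key false) (key true)

/-- Summation of the terms of a class of partitions by the number of parts. -/
theorem genFunEq_of_summable {a b k r : ℕ} (ha : 1 ≤ a) (hab : a < b) (hbk : b ≤ k) {μ ν q : A}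
    (hmul : ∀ {ι κ : Type} (f : ι → A) (g : κ → A), Summable f → Summable g →
      Summable fun x : ι × κ => f x.1 * g x.2)
    (hq : ∀ n, 1 ≤ n → Summable fun e : ℕ => (q ^ n) ^ e) {lim : Bool} {𝒞 : Set Ptn}
    (h𝒞 : ∀ π, π ∈ 𝒞 ↔ (∀ x ∈ π.2.parts, x ≡ a [MOD k] ∨ x ≡ b [MOD k]) ∧
      ¬ π.HasConsecutive k (letterResidue a b lim) (r + 1))
    (hs : Summable fun π : 𝒞 => ptnTerm a b k μ ν q π) {T : ℕ → A}
    (hT : ∀ m, T m = Ring.inverse (qShifted (q ^ k) (q ^ k) m) *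
      wordSum (q ^ k) (letterWeight a b μ ν q) lim r false 0 m) :
    GenFunEq a b k μ ν q 𝒞 T := by
  have hQ : ∀ n, 1 ≤ n → Summable fun e : ℕ => ((q ^ k) ^ n) ^ e := fun n hn => by
    rw [← pow_mul]
    exact hq _ (Nat.mul_pos (by omega) hn)
  have h1 := hs.hasSum
  rw [show (fun π : 𝒞 => ptnTerm a b k μ ν q π) = ptnTerm a b k μ ν q ∘ Subtype.val from rfl,
    hasSum_subtype_iff_indicator, ← (codePtn_injective (k := k) ha hab hbk).hasSum_iff] at h1
  · have h2 : (𝒞.indicator (ptnTerm a b k μ ν q)) ∘ codePtn (k := k) ha hab =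
        codeTerm (q ^ k) (letterWeight a b μ ν q) lim r false 0 := by
      funext t
      classical
      rw [Function.comp_apply, Set.indicator_apply, codeTerm, ptnTerm_codePtn ha hab hbk]
      refine if_congr ?_ rfl rfl
      rw [h𝒞, ← hasConsecutive_codePtn ha hab hbk]
      exact and_iff_right (codePtn_modEq ha hab t)
    rw [h2, ← (Equiv.sigmaFiberEquiv (List.length (α := Bool × ℕ))).hasSum_iff] at h1
    have h3 : HasSum T (∑' π : 𝒞, ptnTerm a b k μ ν q π) := by
      -- Codes are grouped by length, so the sum over `m` converges because the sum over all codes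
      -- does.
      refine h1.sigma fun m => ?_
      rw [hT]
      exact hasSum_codeTerm hmul hQ _ lim r m false 0
    have h0 : T 0 = 1 := by simp [hT, wordSum, qShifted]
    -- The term `m = 0` is the empty partition.
    have h4 : HasSum (fun m : ℕ+ => T m) ((∑' π : 𝒞, ptnTerm a b k μ ν q π) - 1) := by
      rw [← Equiv.pnatEquivNat.symm.hasSum_iff]
      have h5 := (hasSum_nat_add_iff' 1).2 h3
      simpa [h0, Function.comp_def] using h5
    exact ⟨hs, h4.summable, by rw [h4.tsum_eq]; ring⟩
  · intro π hπ
    refine Set.indicator_of_notMem (fun h => hπ ?_) _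
    exact mem_range_codePtn ha hab hbk ((h𝒞 π).1 h).1

end CodeTerm

/-! ### Convergence of formal power series. -/

section PowerSeriesSummable

variable {R : Type*} [CommRing R] [TopologicalSpace R] [DiscreteTopology R]

theorem PowerSeries.summable_iff_finite_support_coeff {ι : Type*} {f : ι → PowerSeries R} :
    Summable f ↔ ∀ d, (Function.support fun i => PowerSeries.coeff d (f i)).Finite := by
  rw [PowerSeries.WithPiTopology.summable_iff_summable_coeff]
  exact forall_congr' fun d =>
    ⟨fun h => h.hasFiniteSupport_of_discreteTopology, fun h => summable_of_hasFiniteSupport h⟩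

theorem PowerSeries.summable_mul_of_discrete {ι κ : Type*} (f : ι → PowerSeries R)
    (g : κ → PowerSeries R) (hf : Summable f) (hg : Summable g) :
    Summable fun x : ι × κ => f x.1 * g x.2 := by
  rw [PowerSeries.summable_iff_finite_support_coeff] at *
  intro d
  refine Set.Finite.subset (Set.Finite.biUnion
    (Finset.HasAntidiagonal.antidiagonal d).finite_toSet
    fun p _ => (hf p.1).prod (hg p.2)) fun x hx => ?_
  rw [Function.mem_support, PowerSeries.coeff_mul] at hx
  obtain ⟨p, hp, hne⟩ := Finset.exists_ne_zero_of_sum_ne_zero hx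
  exact Set.mem_biUnion (Finset.mem_coe.2 hp) ⟨left_ne_zero_of_mul hne, right_ne_zero_of_mul hne⟩

theorem finite_setOf_weight_eq (n : ℕ) : {π : Ptn | π.weight = n}.Finite := by
  refine (Set.finite_range fun P : n.Partition => (⟨n, P⟩ : Ptn)).subset ?_
  rintro ⟨m, P⟩ rfl
  exact ⟨P, rfl⟩

theorem summable_ptnTerm_powerSeries (a b k : ℕ) (μ ν : R) (𝒞 : Set Ptn) :
    Summable fun π : 𝒞 => ptnTerm a b k (PowerSeries.C μ) (PowerSeries.C ν)
      (PowerSeries.X : PowerSeries R) π := by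
  rw [PowerSeries.summable_iff_finite_support_coeff]
  intro d
  refine ((finite_setOf_weight_eq d).preimage Subtype.val_injective.injOn).subset fun π hπ => ?_
  by_contra hne
  refine hπ ?_
  rw [Set.mem_preimage, Set.mem_ofPred_eq] at hne
  dsimp only
  rw [ptnTerm, ← map_pow, ← map_pow, ← map_mul, PowerSeries.coeff_C_mul, PowerSeries.coeff_X_pow,
    if_neg (Ne.symm hne), mul_zero]

end PowerSeriesSummable

/-! ### Absolute convergence over the complex numbers. -/

section ComplexSummable

theorem prefix_of_pairwise_ge (x : ℕ) {l : List ℕ} (hl : l.Pairwise (· ≥ ·))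
    (hx : ∀ y ∈ l, y ≤ x) : List.replicate (l.count x) x <+: l := by
  induction l with
  | nil => simp
  | cons y l ih =>
    rw [List.pairwise_cons] at hl
    by_cases hy : y = x
    · subst hy
      rw [List.count_cons_self, List.replicate_succ, List.cons_prefix_cons]
      exact ⟨rfl, ih hl.2 fun z hz => hx z (by simp [hz])⟩
    · have hlt : y < x := lt_of_le_of_ne (hx y (by simp)) hy
      rw [List.count_eq_zero_of_not_mem]
      · simp
      · intro hm
        rcases List.mem_cons.1 hm with rfl | hm
        · exact hy rfl
        · exact absurd (hl.1 x hm) (by omega)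

theorem infix_of_pairwise_ge (x : ℕ) {l : List ℕ} (hl : l.Pairwise (· ≥ ·)) :
    List.replicate (l.count x) x <:+: l := by
  induction l with
  | nil => simp
  | cons y l ih =>
    by_cases hy : y = x
    · subst hy
      refine (prefix_of_pairwise_ge y hl fun z hz => ?_).isInfix
      rcases List.mem_cons.1 hz with rfl | hz
      exacts [le_rfl, (List.pairwise_cons.1 hl).1 z hz]
    · rw [List.count_cons_of_ne hy]
      exact (ih hl.of_cons).trans (List.suffix_cons y l).isInfix

/-- Equal parts are consecutive in the sorted list, so the run condition bounds each multiplicity.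
-/
theorem count_le_of_not_hasConsecutive {k d r x : ℕ} {π : Ptn}
    (h : ¬ π.HasConsecutive k d (r + 1)) (hx : x ≡ d [MOD k]) : π.2.parts.count x ≤ r := by
  by_contra hlt
  refine h ⟨List.replicate (r + 1) x, ?_, by simp, fun y hy => List.eq_of_mem_replicate hy ▸ hx⟩
  have h1 := infix_of_pairwise_ge x (Multiset.pairwise_sort π.2.parts (· ≥ ·))
  rw [← Multiset.coe_count, Multiset.sort_eq] at h1
  refine List.IsInfix.trans (List.IsPrefix.isInfix ?_) h1
  rw [List.prefix_replicate_iff]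
  simp
  omega

/-- A family of products over the parts of partitions is summable if the powers of the factor of
each part `x`, up to the multiplicities that occur, sum to at most `1 + y x` with `y` summable. -/
theorem summable_prod_parts {𝒞 : Set Ptn} {c y : ℕ → ℝ} (hc : ∀ x, 0 ≤ c x) (hy0 : ∀ x, 0 ≤ y x)
    (hy : Summable y) (h : ∀ π ∈ 𝒞, ∀ x ∈ π.2.parts,
      ∑ e ∈ Finset.range (π.2.parts.count x + 1), c x ^ e ≤ 1 + y x) :
    Summable fun π : 𝒞 => ((π : Ptn).2.parts.map c).prod := by
  have hnn : ∀ s : Multiset ℕ, 0 ≤ (s.map c).prod := fun s =>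
    Multiset.prod_nonneg fun z hz => by
      obtain ⟨x, -, rfl⟩ := Multiset.mem_map.1 hz
      exact hc x
  refine summable_of_sum_le (c := Real.exp (∑' x, y x)) (fun π => hnn _) fun S => ?_
  let N := S.sup (fun π => (π : Ptn).weight) + 1
  let K : ℕ → ℕ := fun x => S.sup fun π => (π : Ptn).2.parts.count x
  have hN : ∀ π ∈ S, ∀ x ∈ (π : Ptn).2.parts, x < N := fun π hπ x hx => by
    have h1 : x ≤ (π : Ptn).weight := by
      have := Multiset.le_sum_of_mem hx
      rwa [(π : Ptn).2.parts_sum] at this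
    exact Nat.lt_succ_of_le (h1.trans (Finset.le_sup (f := fun π : 𝒞 => (π : Ptn).weight) hπ))
  -- Multiplicities embed the finite set `S` into a box with sides `K i + 1`; the sum over the box
  -- factors, and `1 + y ≤ exp y` bounds the product.
  let φ : 𝒞 → Fin N → ℕ := fun π i => (π : Ptn).2.parts.count (i : ℕ)
  have hφ : Set.InjOn φ S := fun π hπ π' hπ' he => by
    refine Subtype.ext (Ptn.ext_parts (Multiset.ext.2 fun x => ?_))
    by_cases hx : x < N
    · exact congrFun he ⟨x, hx⟩
    · rw [Multiset.count_eq_zero_of_notMem fun hm => hx (hN π hπ x hm),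
        Multiset.count_eq_zero_of_notMem fun hm => hx (hN π' hπ' x hm)]
  have hterm : ∀ π ∈ S, ((π : Ptn).2.parts.map c).prod = ∏ i : Fin N, c i ^ φ π i :=
      fun π hπ => by
    have h1 := Finset.prod_range (n := N) fun i => c i ^ (π : Ptn).2.parts.count i
    rw [Finset.prod_multiset_map_count]
    refine Eq.trans ?_ h1
    refine Finset.prod_subset (fun x hx => ?_) fun x _ hx => ?_
    · exact Finset.mem_range.2 (hN π hπ x (Multiset.mem_toFinset.1 hx))
    · rw [Multiset.count_eq_zero_of_notMem (by simpa using hx), pow_zero]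
  -- The largest multiplicity of `x` is attained in `S`, and the hypothesis applies to that
  -- partition.
  have hK : ∀ x, ∑ e ∈ Finset.range (K x + 1), c x ^ e ≤ 1 + y x := fun x => by
    by_cases h0 : K x = 0
    · simp [h0, hy0]
    · have hS : S.Nonempty := by
        rw [Finset.nonempty_iff_ne_empty]
        rintro rfl
        exact h0 rfl
      obtain ⟨π, _, hπ⟩ := Finset.exists_mem_eq_sup S hS fun π => (π : Ptn).2.parts.count x
      have hKπ : K x = (π : Ptn).2.parts.count x := hπ
      rw [hKπ]
      exact h π π.2 x (Multiset.count_ne_zero.1 (hKπ ▸ h0))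
  calc ∑ π ∈ S, ((π : Ptn).2.parts.map c).prod
      = ∑ f ∈ S.image φ, ∏ i : Fin N, c i ^ f i := by
        rw [Finset.sum_image hφ]
        exact Finset.sum_congr rfl hterm
    _ ≤ ∑ f ∈ Fintype.piFinset fun i : Fin N => Finset.range (K i + 1), ∏ i : Fin N, c i ^ f i := by
        refine Finset.sum_le_sum_of_subset_of_nonneg (fun f hf => ?_) fun f _ _ =>
          Finset.prod_nonneg fun i _ => pow_nonneg (hc _) _
        obtain ⟨π, hπ, rfl⟩ := Finset.mem_image.1 hf
        rw [Fintype.mem_piFinset]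
        intro i
        exact Finset.mem_range.2 (Nat.lt_succ_of_le
          (Finset.le_sup (f := fun π : 𝒞 => (π : Ptn).2.parts.count (i : ℕ)) hπ))
    _ = ∏ i : Fin N, ∑ e ∈ Finset.range (K i + 1), c i ^ e := (Finset.prod_univ_sum _ _).symm
    _ ≤ ∏ i : Fin N, Real.exp (y i) := by
        refine Finset.prod_le_prod (fun i _ => Finset.sum_nonneg fun e _ => pow_nonneg (hc _) _)
          fun i _ => (hK i).trans ?_
        rw [add_comm]
        exact Real.add_one_le_exp _
    _ = Real.exp (∑ i ∈ Finset.range N, y i) := by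
        rw [Finset.sum_range, Real.exp_sum]
    _ ≤ Real.exp (∑' x, y x) := Real.exp_le_exp.2 (hy.sum_le_tsum _ fun i _ => hy0 i)

theorem summable_ptnTerm_complex {a b k r : ℕ} (ha : 1 ≤ a) (hab : a < b) (hbk : b ≤ k)
    {μ ν q : ℂ} (hq : ‖q‖ < 1) {lim : Bool} (hz : ‖letterWeight a b μ ν q (!lim)‖ < 1)
    {𝒞 : Set Ptn}
    (h𝒞 : ∀ π, π ∈ 𝒞 ↔ (∀ x ∈ π.2.parts, x ≡ a [MOD k] ∨ x ≡ b [MOD k]) ∧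
      ¬ π.HasConsecutive k (letterResidue a b lim) (r + 1)) :
    Summable fun π : 𝒞 => ptnTerm a b k μ ν q π := by
  let c : ℕ → ℝ := fun x => if x ≡ a [MOD k] then ‖μ‖ * ‖q‖ ^ x else ‖ν‖ * ‖q‖ ^ x
  have hc : ∀ x, 0 ≤ c x := fun x => by
    simp only [c]
    split_ifs <;> positivity
  have hca : ∀ M d, c (k * M + letterResidue a b d) =
      (if d then ‖ν‖ else ‖μ‖) * ‖q‖ ^ (k * M + letterResidue a b d) := fun M d => by
    have h := level_modEq_iff ha hab hbk M d false
    rw [show letterResidue a b false = a from rfl] at h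
    simp only [c, h]
    cases d <;> simp
  have hcz : ∀ M d, c (k * M + letterResidue a b d) ≤ ‖letterWeight a b μ ν q d‖ := fun M d => by
    have h : ‖q‖ ^ (k * M + letterResidue a b d) ≤ ‖q‖ ^ letterResidue a b d :=
      pow_le_pow_of_le_one (norm_nonneg q) hq.le (Nat.le_add_left _ _)
    rw [hca]
    cases d
    · simpa [letterWeight, letterResidue] using mul_le_mul_of_nonneg_left h (norm_nonneg μ)
    · simpa [letterWeight, letterResidue] using mul_le_mul_of_nonneg_left h (norm_nonneg ν)
  have hsum : Summable c := by
    refine Summable.of_nonneg_of_le hc (fun x => ?_)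
      ((summable_geometric_of_lt_one (norm_nonneg q) hq).mul_left (‖μ‖ + ‖ν‖))
    have h1 := mul_nonneg (norm_nonneg μ) (pow_nonneg (norm_nonneg q) x)
    have h2 := mul_nonneg (norm_nonneg ν) (pow_nonneg (norm_nonneg q) x)
    simp only [c, add_mul]
    split_ifs <;> linarith
  have hnorm : ∀ s : Multiset ℕ, (∀ x ∈ s, x ≡ a [MOD k] ∨ x ≡ b [MOD k]) → (∀ x ∈ s, 1 ≤ x) →
      ‖μ‖ ^ s.countP (fun x => x ≡ a [MOD k]) * ‖ν‖ ^ s.countP (fun x => x ≡ b [MOD k]) *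
        ‖q‖ ^ s.sum = (s.map c).prod := by
    intro s
    induction s using Multiset.induction with
    | empty => simp
    | cons x s ih =>
      intro h1 h2
      have hs := ih (fun y hy => h1 y (by simp [hy])) fun y hy => h2 y (by simp [hy])
      obtain ⟨M, d, rfl⟩ := exists_level hab hbk (h2 x (by simp)) (h1 x (by simp))
      have hf := level_modEq_iff ha hab hbk M d false
      have ht := level_modEq_iff ha hab hbk M d true
      rw [show letterResidue a b false = a from rfl] at hf
      rw [show letterResidue a b true = b from rfl] at ht
      rw [Multiset.map_cons, Multiset.prod_cons, ← hs, hca, Multiset.countP_cons,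
        Multiset.countP_cons, Multiset.sum_cons]
      simp only [hf, ht]
      cases d <;> simp <;> ring
  let ρ := ‖letterWeight a b μ ν q (!lim)‖
  let Z := ‖letterWeight a b μ ν q lim‖
  have hρ : 0 ≤ (1 - ρ)⁻¹ := inv_nonneg.2 (sub_nonneg.2 hz.le)
  have hZ : 0 ≤ ∑ e ∈ Finset.range r, Z ^ e :=
    Finset.sum_nonneg fun e _ => pow_nonneg (norm_nonneg _) e
  -- Beyond the term `1`, a factor `c x` splits off. The rest is at most a geometric series of ratio
  -- `ρ < 1` for the free residue, and at most `r` powers of `Z`, which need not be below `1`, for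
  -- the limited one.
  have key := summable_prod_parts (𝒞 := 𝒞) hc
    (y := fun x => c x * ((1 - ρ)⁻¹ + ∑ e ∈ Finset.range r, Z ^ e))
    (fun x => mul_nonneg (hc x) (add_nonneg hρ hZ)) (hsum.mul_right _) fun π hπ x hx => by
      obtain ⟨h1, h2⟩ := (h𝒞 π).1 hπ
      rw [Finset.sum_range_succ', pow_zero, add_comm]
      simp only [pow_succ', ← Finset.mul_sum]
      refine add_le_add_right (mul_le_mul_of_nonneg_left ?_ (hc x)) 1
      obtain ⟨M, d, rfl⟩ := exists_level hab hbk (π.2.parts_pos hx) (h1 x hx)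
      by_cases hd : d = lim
      · subst hd
        have hcount := count_le_of_not_hasConsecutive h2
          ((level_modEq_iff ha hab hbk M d d).2 rfl)
        refine le_trans ?_ (le_add_of_nonneg_left hρ)
        refine (Finset.sum_le_sum fun e _ => pow_le_pow_left₀ (hc _) (hcz M d) e).trans ?_
        exact Finset.sum_le_sum_of_subset_of_nonneg (Finset.range_subset_range.2 hcount)
          fun e _ _ => pow_nonneg (norm_nonneg _) e
      · have hd' : d = !lim := by cases d <;> cases lim <;> simp_all
        subst hd'
        refine le_trans ?_ (le_add_of_nonneg_right hZ)
        refine (Finset.sum_le_sum fun e _ => pow_le_pow_left₀ (hc _) (hcz M _) e).trans ?_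
        rw [← tsum_geometric_of_lt_one (norm_nonneg _) hz]
        exact (summable_geometric_of_lt_one (norm_nonneg _) hz).sum_le_tsum _
          fun e _ => pow_nonneg (norm_nonneg _) e
  refine Summable.of_norm (key.congr fun π => ?_)
  obtain ⟨h1, -⟩ := (h𝒞 π).1 π.2
  rw [← hnorm _ h1 fun x hx => (π : Ptn).2.parts_pos hx, (π : Ptn).2.parts_sum]
  simp [ptnTerm, Ptn.ell, Ptn.weight]

end ComplexSummable

end

/-! ### Both identities, formally and analytically. -/

theorem mainTheorem1 (a b k r : ℕ) (ha : 1 ≤ a) (hab : a < b) (hbk : b ≤ k) (hr : 1 ≤ r) :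
    -- as identities of formal power series in `q`
    (∀ (R : Type*) [CommRing R] [TopologicalSpace R] [DiscreteTopology R] (μ ν : R),
      GenFunEq a b k (PowerSeries.C μ) (PowerSeries.C ν) (PowerSeries.X : PowerSeries R)
        (classP a b k r)
        (seriesTermP a b k r (PowerSeries.C μ) (PowerSeries.C ν) PowerSeries.X) ∧
      GenFunEq a b k (PowerSeries.C μ) (PowerSeries.C ν) (PowerSeries.X : PowerSeries R)
        (classP' a b k r)
        (seriesTermP' a b k r (PowerSeries.C μ) (PowerSeries.C ν) PowerSeries.X)) ∧
    -- as identities of convergent series of complex numbers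
    (∀ μ ν q : ℂ, ‖q‖ < 1 →
      (‖μ * q ^ a‖ < 1 → GenFunEq a b k μ ν q (classP a b k r) (seriesTermP a b k r μ ν q)) ∧
      (‖ν * q ^ b‖ < 1 →
        GenFunEq a b k μ ν q (classP' a b k r) (seriesTermP' a b k r μ ν q))) := by
  have hk : 1 ≤ k := by omega
  have h𝒞 : ∀ π, π ∈ classP a b k r ↔ (∀ x ∈ π.2.parts, x ≡ a [MOD k] ∨ x ≡ b [MOD k]) ∧
      ¬ π.HasConsecutive k (letterResidue a b true) (r + 1) := fun _ => Iff.rfl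
  have h𝒞' : ∀ π, π ∈ classP' a b k r ↔ (∀ x ∈ π.2.parts, x ≡ a [MOD k] ∨ x ≡ b [MOD k]) ∧
      ¬ π.HasConsecutive k (letterResidue a b false) (r + 1) := fun _ => Iff.rfl
  refine ⟨fun R _ _ _ μ ν => ?_, fun μ ν q hq => ?_⟩
  · have hX : ∀ n, 1 ≤ n → Summable fun e : ℕ => ((PowerSeries.X : PowerSeries R) ^ n) ^ e :=
      fun n hn => PowerSeries.WithPiTopology.summable_pow_of_constantCoeff_eq_zero (by
        simp [Nat.one_le_iff_ne_zero.1 hn])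
    have hu := fun n (hn : 1 ≤ n) => isUnit_one_sub_of_summable (hX n hn)
    have hmul : ∀ {ι κ : Type} (f : ι → PowerSeries R) (g : κ → PowerSeries R), Summable f →
        Summable g → Summable fun x : ι × κ => f x.1 * g x.2 :=
      fun f g hf hg => PowerSeries.summable_mul_of_discrete f g hf hg
    exact ⟨genFunEq_of_summable ha hab hbk hmul hX h𝒞
        (summable_ptnTerm_powerSeries a b k μ ν _) fun m => seriesTermP_eq hk hr hu m,
      genFunEq_of_summable ha hab hbk hmul hX h𝒞'
        (summable_ptnTerm_powerSeries a b k μ ν _) fun m => seriesTermP'_eq hk hr hu m⟩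
  · have hX : ∀ n, 1 ≤ n → Summable fun e : ℕ => (q ^ n) ^ e := fun n hn =>
      summable_geometric_of_norm_lt_one (by
        rw [norm_pow]
        exact pow_lt_one₀ (norm_nonneg q) hq (by omega))
    have hu := fun n (hn : 1 ≤ n) => isUnit_one_sub_of_summable (hX n hn)
    have hmul : ∀ {ι κ : Type} (f : ι → ℂ) (g : κ → ℂ), Summable f → Summable g →
        Summable fun x : ι × κ => f x.1 * g x.2 :=
      fun f g hf hg => summable_mul_of_summable_norm hf.norm hg.norm
    exact ⟨fun hz => genFunEq_of_summable ha hab hbk hmul hX h𝒞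
        (summable_ptnTerm_complex ha hab hbk hq (by simpa [letterWeight] using hz) h𝒞)
        fun m => seriesTermP_eq hk hr hu m,
      fun hz => genFunEq_of_summable ha hab hbk hmul hX h𝒞'
        (summable_ptnTerm_complex ha hab hbk hq (by simpa [letterWeight] using hz) h𝒞')
        fun m => seriesTermP'_eq hk hr hu m⟩
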